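/- For a norm $\|\cdot\|_X$ on $\mathbb R^n$ write $X=(\mathbb R^n,\|\cdot\|_X)$, and let $\|T\|_X$ be the norm of a linear operator $T\in L(\mathbb R^n)$ as an operator from $X$ to $X$. Let $\|\cdot\|_1$, $\|\cdot\|_2$ be the $\ell_1$ and the Euclidean norm on $\mathbb R^n$. For $u:X\to X$ and an integer $k\ge 1$, the $k$-th Gelfand number of $u$ is $c_k(u)=\inf\{\|u|_Z : Z\to X\| : Z\subset X \text{ a subspace},\ \operatorname{codim} Z<k\}$, where $Z$ carries the norm $\|\cdot\|_X$. For $c>0$ call $\|\cdot\|_X$ a *Mankiewicz norm with constant* $c$ if (i) $X$ is isometrically isomorphic to a quotient of $\ell_1^{2n}$; (ii) $\|x\|_2\le\|x\|_X\le\|x\|_1$ for every $x\in\mathbb R^n$; (iii) for every $T\in L(\mathbb R^n)$ there are $\lambda_T\in\mathbb R$ and a linear subspace $E_T\subset\mathbb R^n$ with $\dim E_T>\frac{7n}{8}$ such that $|\lambda_T|\le c\|T\|_X$ and $\|(T+\lambda_T\mathrm{Id})x\|_2\le c\,n^{-1/2}\|T\|_X\|x\|_2$ for all $x\in E_T$.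 **Theorem.** There is a numerical constant $c>0$ such that for every $n\ge 2$ there is a Mankiewicz norm with constant $c$ on $\mathbb R^n$. Moreover, for every $c>0$ there are constants $K>0$ and $\kappa>0$, depending only on $c$, such that for every $n\ge 2$ and every Mankiewicz norm $\|\cdot\|_{X_n}$ with constant $c$ on $\mathbb R^n$, with the Gelfand numbers taken in $X_n$: (a) for every $T\in L(\mathbb R^n)$, $$\inf_{\lambda\in\mathbb R} c_{\lfloor n/2\rfloor}(T-\lambda\,\mathrm{Id})\le K n^{-1/2}\|T\|_{X_n};$$ (b) this is best possible up to the constant: there is a nonzero $T\in L(\mathbb R^n)$ with $$\inf_{\lambda\in\mathbb R} c_{\lfloor n/2\rfloor}(T-\lambda\,\mathrm{Id})\ge \kappa n^{-1/2}\|T\|_{X_n}.$$ -/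

import Mathlib

/-- `ℝⁿ` with its Euclidean norm `‖·‖₂`. -/
abbrev Rn (n : ℕ) : Type := EuclideanSpace ℝ (Fin n)

/-- A norm on the vector space `ℝⁿ` (in general different from the Euclidean norm). -/
structure NormOn (n : ℕ) extends Seminorm ℝ (Rn n) where
  eq_zero_of_toFun_eq_zero : ∀ x, toFun x = 0 → x = 0

namespace NormOn

variable {n : ℕ}

/-- The vector space `ℝⁿ`, to be equipped with the norm `X` instead of the Euclidean one. -/
def Space (_X : NormOn n) : Type := Rn n

instance (X : NormOn n) : AddCommGroup X.Space := inferInstanceAs (AddCommGroup (Rn n))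

instance (X : NormOn n) : Module ℝ X.Space := inferInstanceAs (Module ℝ (Rn n))

instance (X : NormOn n) : FiniteDimensional ℝ X.Space :=
  inferInstanceAs (FiniteDimensional ℝ (Rn n))

/-- The identity map from `ℝⁿ` to the normed space `(ℝⁿ, X)`. -/
def toSpace (X : NormOn n) : Rn n ≃ₗ[ℝ] X.Space := LinearEquiv.refl ℝ (Rn n)

noncomputable instance (X : NormOn n) : NormedAddCommGroup X.Space :=
  AddGroupNorm.toNormedAddCommGroup
    { toFun := fun x => X.toSeminorm (X.toSpace.symm x)
      map_zero' := by simp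
      add_le' := fun x y => by
        rw [map_add]
        exact map_add_le_add _ _ _
      neg' := fun x => by
        rw [map_neg]
        exact map_neg_eq_map _ _
      eq_zero_of_map_eq_zero' := fun x h =>
        X.toSpace.symm.map_eq_zero_iff.1 (X.eq_zero_of_toFun_eq_zero _ h) }

theorem norm_toSpace (X : NormOn n) (x : Rn n) : ‖X.toSpace x‖ = X.toSeminorm x := rfl

noncomputable instance (X : NormOn n) : NormedSpace ℝ X.Space where
  norm_smul_le a x := (map_smul_eq_mul X.toSeminorm a (X.toSpace.symm x)).le

/-- The operator `T` on `ℝⁿ`, regarded as an operator from `(ℝⁿ, X)` to itself. In particular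
`‖X.op T‖` is the norm of `T` as an operator on `(ℝⁿ, X)`. -/
noncomputable def op (X : NormOn n) (T : Rn n →L[ℝ] Rn n) : X.Space →L[ℝ] X.Space :=
  LinearMap.toContinuousLinearMap (X.toSpace.conj T.toLinearMap)

theorem op_toSpace (X : NormOn n) (T : Rn n →L[ℝ] Rn n) (x : Rn n) :
    X.op T (X.toSpace x) = X.toSpace (T x) := rfl

end NormOn

/-- The `k`-th Gelfand number (`k ≥ 1`) of `u : X → Y`: the infimum of the norms of the
restrictions of `u` to the subspaces `Z` of `X` with `codim Z < k`. -/
noncomputable def gelfandNumber {X Y : Type*} [NormedAddCommGroup X] [NormedSpace ℝ X]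
    [NormedAddCommGroup Y] [NormedSpace ℝ Y] (k : ℕ) (u : X →L[ℝ] Y) : ℝ :=
  ⨅ Z : {Z : Submodule ℝ X // Module.rank ℝ (X ⧸ Z) < k}, ‖u.comp Z.1.subtypeL‖

/-- The norm `X` on `ℝⁿ` is a Mankiewicz norm with constant `c`. The restriction of
`T + l Id` to `E` is measured in the Euclidean operator norm, and `T` in the operator norm
of `(ℝⁿ, X)`. -/
structure IsMankiewiczNorm (c : ℝ) {n : ℕ} (X : NormOn n) : Prop where
  /-- `(ℝⁿ, X)` is isometrically isomorphic to a quotient of `ℓ₁²ⁿ`. -/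
  quotient : ∃ S : Submodule ℝ (PiLp 1 fun _ : Fin (2 * n) => ℝ),
    Nonempty (((PiLp 1 fun _ : Fin (2 * n) => ℝ) ⧸ S) ≃ₗᵢ[ℝ] X.Space)
  /-- The norm lies between the Euclidean norm and the `ℓ₁` norm. -/
  euclidean_le : ∀ x : Rn n, ‖x‖ ≤ X.toSeminorm x
  le_l1 : ∀ x : Rn n, X.toSeminorm x ≤ ∑ i, |x i|
  /-- Each operator is, on a large subspace, a small perturbation of a multiple of `Id`. -/
  perturbation : ∀ T : Rn n →L[ℝ] Rn n, ∃ (l : ℝ) (E : Submodule ℝ (Rn n)),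
    (7 * n / 8 : ℝ) < Module.finrank ℝ E ∧
    |l| ≤ c * ‖X.op T‖ ∧
    ‖(T + l • ContinuousLinearMap.id ℝ (Rn n)).comp E.subtypeL‖ ≤
      c * (n : ℝ) ^ (-1 / 2 : ℝ) * ‖X.op T‖

/-! Existence is a random-polytope argument in the style of Gluskin. For `n ≥ 256` the unit ball is
the absolutely convex hull of the unit vectors and of `m = ⌊n/256⌋` points `g_j` of the cube
`[-n^{-1/2}, n^{-1/2}]ⁿ`. A contraction `T` sends these vertices into the hull. Rounding the
coefficients to multiples of `1/n` gives `T = P + ∑ Q_j(·) g_j + R` with `R` small in the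
Hilbert-Schmidt sense and `(P, Q)` in a grid of size `exp(O(n²))`. Evaluating `T g_j` in two ways
then forces a quadratic expression in the `g_j` (`quadDefect`) to be small. If `P` moves a
`2m`-dimensional subspace away from itself, this happens only on a set of tuples of relative volume
`exp(O(n²)) s^{-m²}` (`volume_quadDefect_le`). For a large constant `s` a union bound leaves a tuple
that is good for the whole grid (`exists_tuple_gridDefect`). For this tuple `P` moves no such
subspace, so it is near a multiple of the identity on small codimension
(`exists_moved_submodule_or_near_scalar`), and so is `T`.

The Gelfand estimates rest on one more fact: a quotient of `ℓ₁²ⁿ` whose norm dominates the Euclidean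
one satisfies `√n ‖x‖₂ ≤ C ‖x‖_X` on a subspace `Z₀` of codimension at most `n/8`
(`exists_sqrt_mul_norm_le`), again by rounding, counting and a volume estimate. Since `‖x‖_X ≤ √n
‖x‖₂` everywhere, the two norms are proportional on `Z₀` up to constants. Hence (iii) becomes (a) on
`Z₀ ∩ E`. For (b), an antisymmetric near-isometry `T` has `‖T‖_X ≤ √n`, while `‖(T - λ)x‖₂ ≥ ‖x‖₂`
on a hyperplane for every `λ`. Hence every subspace allowed in the Gelfand number contains some `x ≠
0` with `(T - λ)x ∈ Z₀`, which bounds the number below by `1/C`. -/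

/-! ### Rounding to integer coefficients and counting the results. -/

/-- Greedy rounding: of the two integers around `u a`, take the one for which the cross term with
the error so far is not positive. Each vector then adds at most its own squared norm, without any
orthogonality of the `v k`. -/
theorem exists_int_rounding {H κ : Type*} [NormedAddCommGroup H] [InnerProductSpace ℝ H]
    (s : Finset κ) (v : κ → H) (u : κ → ℝ) :
    ∃ z : κ → ℤ, (∀ k, |(z k : ℝ)| ≤ |u k| + 1) ∧
      ‖∑ k ∈ s, (u k - z k) • v k‖ ^ 2 ≤ ∑ k ∈ s, ‖v k‖ ^ 2 := by
  classical
  induction s using Finset.induction_on with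
  | empty =>
    refine ⟨fun k => ⌊u k⌋, fun k => ?_, by simp⟩
    rw [abs_le]
    have h1 := Int.floor_le (u k)
    have h2 := Int.lt_floor_add_one (u k)
    have h3 := neg_abs_le (u k)
    have h4 := le_abs_self (u k)
    constructor <;> linarith
  | insert a s ha ih =>
    obtain ⟨z, hz, hs⟩ := ih
    set S := ∑ k ∈ s, (u k - z k) • v k with hS
    have key : ∃ c : ℤ, |(c : ℝ)| ≤ |u a| + 1 ∧
        ‖(u a - c) • v a + S‖ ^ 2 ≤ ‖v a‖ ^ 2 + ‖S‖ ^ 2 := by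
      have h1 := Int.floor_le (u a)
      have h2 := Int.lt_floor_add_one (u a)
      have h3 := neg_abs_le (u a)
      have h4 := le_abs_self (u a)
      have expand : ∀ t : ℝ, ‖t • v a + S‖ ^ 2 =
          t ^ 2 * ‖v a‖ ^ 2 + 2 * t * inner ℝ (v a) S + ‖S‖ ^ 2 := by
        intro t
        rw [norm_add_sq_real, norm_smul, real_inner_smul_left, mul_pow, Real.norm_eq_abs, sq_abs]
        ring
      by_cases hin : 0 ≤ inner ℝ (v a) S
      · refine ⟨⌊u a⌋ + 1, ?_, ?_⟩
        · push_cast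
          rw [abs_le]
          constructor <;> linarith
        · rw [expand]
          push_cast
          have ht0 : u a - (⌊u a⌋ + 1) ≤ 0 := by linarith
          have ht1 : (u a - (⌊u a⌋ + 1)) ^ 2 ≤ 1 := by nlinarith
          nlinarith [mul_nonneg (neg_nonneg.2 ht0) hin, sq_nonneg ‖v a‖,
            mul_le_mul_of_nonneg_right ht1 (sq_nonneg ‖v a‖)]
      · refine ⟨⌊u a⌋, ?_, ?_⟩
        · rw [abs_le]
          constructor <;> linarith
        · rw [expand]
          have ht0 : 0 ≤ u a - ⌊u a⌋ := by linarith
          have ht1 : (u a - ⌊u a⌋) ^ 2 ≤ 1 := by nlinarith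
          nlinarith [mul_nonneg ht0 (neg_nonneg.2 (not_le.1 hin).le), sq_nonneg ‖v a‖,
            mul_le_mul_of_nonneg_right ht1 (sq_nonneg ‖v a‖)]
    obtain ⟨c, hc, hcS⟩ := key
    refine ⟨Function.update z a c, fun k => ?_, ?_⟩
    · by_cases hk : k = a
      · subst hk; simpa using hc
      · simpa [Function.update_of_ne hk] using hz k
    · rw [Finset.sum_insert ha, Finset.sum_insert ha, Function.update_self]
      have : ∑ k ∈ s, (u k - (Function.update z a c k : ℤ)) • v k = S := by
        refine Finset.sum_congr rfl fun k hk => ?_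
        rw [Function.update_of_ne (ne_of_mem_of_not_mem hk ha)]
      rw [this]
      linarith

theorem sum_Icc_half_pow_natAbs_le (B : ℕ) :
    ∑ a ∈ Finset.Icc (-(B : ℤ)) B, (1 / 2 : ℝ) ^ a.natAbs ≤ 3 := by
  have h : ∀ B : ℕ, ∑ a ∈ Finset.Icc (-(B : ℤ)) B, (1 / 2 : ℝ) ^ a.natAbs =
      3 - 2 * (1 / 2 : ℝ) ^ B := by
    intro B
    induction B with
    | zero => norm_num
    | succ B ih =>
      have e : Finset.Icc (-((B + 1 : ℕ) : ℤ)) ((B + 1 : ℕ) : ℤ) =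
          insert (-((B + 1 : ℕ) : ℤ)) (insert (((B + 1 : ℕ) : ℤ)) (Finset.Icc (-(B : ℤ)) B)) := by
        ext x
        simp only [Finset.mem_Icc, Finset.mem_insert]
        omega
      rw [e, Finset.sum_insert, Finset.sum_insert, ih]
      · simp only [Int.natAbs_neg, Int.natAbs_natCast]
        ring
      · simp
      · simp only [Finset.mem_insert, Finset.mem_Icc]
        omega
  rw [h]
  have : (0 : ℝ) ≤ (1 / 2 : ℝ) ^ B := by positivity
  linarith

/-- The integer points of an `ℓ₁` ball are few. -/
theorem exists_finset_int_l1_ball (κ : Type*) [Fintype κ] (B : ℕ) :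
    ∃ F : Finset (κ → ℤ), (∀ z : κ → ℤ, (∑ k, |(z k : ℝ)|) ≤ B → z ∈ F) ∧
      (F.card : ℝ) ≤ 2 ^ B * 3 ^ Fintype.card κ := by
  classical
  set box : Finset (κ → ℤ) := Fintype.piFinset fun _ => Finset.Icc (-(B : ℤ)) B
  refine ⟨box.filter fun z => ∑ k, (z k).natAbs ≤ B, fun z hz => ?_, ?_⟩
  · have hz' : ∑ k, (z k).natAbs ≤ B := by
      have : ((∑ k, (z k).natAbs : ℕ) : ℝ) ≤ B := by
        push_cast
        simpa [Nat.cast_natAbs] using hz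
      exact_mod_cast this
    simp only [Finset.mem_filter, hz', and_true, box, Fintype.mem_piFinset, Finset.mem_Icc]
    intro k
    have := (Finset.single_le_sum (f := fun k => (z k).natAbs) (fun _ _ => Nat.zero_le _)
      (Finset.mem_univ k)).trans hz'
    omega
  -- The weight `2^(B - ∑|z k|)` is at least `1` on the ball, and its sum over the box factors into
  -- one-dimensional sums, each at most `3`.
  · have h1 : ∀ z ∈ box.filter (fun z => ∑ k, (z k).natAbs ≤ B),
        (1 : ℝ) ≤ 2 ^ B * ∏ k, (1 / 2 : ℝ) ^ (z k).natAbs := by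
      intro z hz
      rw [Finset.prod_pow_eq_pow_sum]
      have h := (Finset.mem_filter.1 hz).2
      calc (1 : ℝ) = 2 ^ B * (1 / 2) ^ B := by rw [← mul_pow]; norm_num
        _ ≤ _ := by
          gcongr 2 ^ B * ?_
          exact pow_le_pow_of_le_one (by norm_num) (by norm_num) h
    calc ((box.filter fun z => ∑ k, (z k).natAbs ≤ B).card : ℝ)
        = ∑ z ∈ box.filter (fun z => ∑ k, (z k).natAbs ≤ B), (1 : ℝ) := by simp
      _ ≤ ∑ z ∈ box.filter (fun z => ∑ k, (z k).natAbs ≤ B),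
            2 ^ B * ∏ k, (1 / 2 : ℝ) ^ (z k).natAbs := Finset.sum_le_sum h1
      _ ≤ ∑ z ∈ box, 2 ^ B * ∏ k, (1 / 2 : ℝ) ^ (z k).natAbs :=
          Finset.sum_le_sum_of_subset_of_nonneg (Finset.filter_subset _ _)
            fun _ _ _ => by positivity
      _ = 2 ^ B * ∏ _k : κ, ∑ a ∈ Finset.Icc (-(B : ℤ)) B, (1 / 2 : ℝ) ^ a.natAbs := by
          rw [← Finset.mul_sum, Finset.prod_univ_sum]
      _ ≤ 2 ^ B * ∏ _k : κ, 3 := by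
          gcongr
          exact sum_Icc_half_pow_natAbs_le B
      _ = _ := by simp

/-! ### Small Hilbert-Schmidt norm, and sets with thin sections. -/

open Module in
/-- An operator with small Hilbert-Schmidt norm is small on a subspace of small codimension. -/
theorem exists_submodule_norm_le_of_sum_sq_le {E F ι : Type*} [NormedAddCommGroup E]
    [InnerProductSpace ℝ E] [FiniteDimensional ℝ E] [NormedAddCommGroup F]
    [InnerProductSpace ℝ F] [FiniteDimensional ℝ F] [Fintype ι] (A : E →ₗ[ℝ] F)
    (b : OrthonormalBasis ι ℝ E) {K t : ℝ} (hK : ∑ i, ‖A (b i)‖ ^ 2 ≤ K) (ht : 0 ≤ t) :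
    ∃ U : Submodule ℝ E, ((finrank ℝ E : ℝ) - finrank ℝ U) * t ^ 2 ≤ K ∧
      ∀ x ∈ U, ‖A x‖ ≤ t * ‖x‖ := by
  classical
  set S : E →ₗ[ℝ] E := LinearMap.adjoint A ∘ₗ A with hS
  have hsym : S.IsSymmetric := fun x y => by
    simp [hS, LinearMap.adjoint_inner_left, LinearMap.adjoint_inner_right]
  have hSin : ∀ x, inner ℝ x (S x) = ‖A x‖ ^ 2 := fun x => by
    simp [hS, LinearMap.adjoint_inner_right]
  set c := hsym.eigenvectorBasis rfl with hc
  set σ := hsym.eigenvalues rfl with hσ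
  have hA : ∀ i, ‖A (c i)‖ ^ 2 = σ i := fun i => by
    rw [← hSin, hc, hsym.apply_eigenvectorBasis, inner_smul_right, real_inner_self_eq_norm_sq,
      ← hc, c.orthonormal.1 i]
    simp [hσ]
  have hσ0 : ∀ i, 0 ≤ σ i := fun i => by rw [← hA]; positivity
  have htr : ∑ i, σ i = ∑ i, ‖A (b i)‖ ^ 2 := by
    have h1 := LinearMap.trace_eq_sum_inner S b
    have h2 := LinearMap.trace_eq_sum_inner S c
    simp only [hSin] at h1 h2
    rw [← h1, h2]
    exact Finset.sum_congr rfl fun i _ => (hA i).symm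
  have hAx : ∀ x, ‖A x‖ ^ 2 = ∑ i, σ i * inner ℝ (c i) x ^ 2 := fun x => by
    rw [← hSin, ← c.sum_inner_mul_inner]
    refine Finset.sum_congr rfl fun i _ => ?_
    rw [← hsym (c i) x, hc, hsym.apply_eigenvectorBasis, inner_smul_left, ← hc,
      real_inner_comm x]
    simp [hσ]
    ring
  -- Chebyshev for the singular values: each discarded eigenvector of `A*A` takes more than `t²` of
  -- a trace that is at most `K`.
  set I : Finset (Fin (finrank ℝ E)) := Finset.univ.filter fun i => t ^ 2 < σ i
  refine ⟨(Submodule.span ℝ (c '' I))ᗮ, ?_, fun x hx => ?_⟩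
  · have h1 : finrank ℝ (Submodule.span ℝ (c '' (I : Set _))) ≤ I.card := by
      have := finrank_span_finset_le_card (R := ℝ) (I.image c)
      rw [Finset.coe_image] at this
      exact this.trans Finset.card_image_le
    have h2 := Submodule.finrank_add_finrank_orthogonal (Submodule.span ℝ (c '' (I : Set _)))
    have h3 : ((finrank ℝ E : ℝ) - finrank ℝ ↥(Submodule.span ℝ (c '' (I : Set _)))ᗮ) ≤ I.card := by
      have h4 : (finrank ℝ (Submodule.span ℝ (c '' (I : Set _))) : ℝ) +
          finrank ℝ ↥(Submodule.span ℝ (c '' (I : Set _)))ᗮ = finrank ℝ E := by exact_mod_cast h2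
      have : (finrank ℝ (Submodule.span ℝ (c '' (I : Set _))) : ℝ) ≤ I.card := by
        exact_mod_cast h1
      linarith
    calc _ ≤ (I.card : ℝ) * t ^ 2 := by gcongr
      _ = ∑ i ∈ I, t ^ 2 := by simp
      _ ≤ ∑ i ∈ I, σ i := Finset.sum_le_sum fun i hi => (Finset.mem_filter.1 hi).2.le
      _ ≤ ∑ i, σ i := Finset.sum_le_sum_of_subset_of_nonneg (Finset.subset_univ _)
          fun i _ _ => hσ0 i
      _ ≤ K := htr ▸ hK
  · have hin : ∀ i ∈ I, inner ℝ (c i) x = 0 := fun i hi =>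
      (Submodule.mem_orthogonal _ _).1 hx _ (Submodule.subset_span ⟨i, hi, rfl⟩)
    have : ‖A x‖ ^ 2 ≤ (t * ‖x‖) ^ 2 := by
      rw [hAx, mul_pow, ← real_inner_self_eq_norm_sq x, ← c.sum_inner_mul_inner, Finset.mul_sum]
      refine Finset.sum_le_sum fun i _ => ?_
      rw [real_inner_comm (c i) x, ← sq]
      by_cases hi : i ∈ I
      · simp [hin i hi]
      · have : σ i ≤ t ^ 2 := by simpa [I] using hi
        gcongr
    exact le_of_sq_le_sq this (by positivity)

open MeasureTheory Module in
/-- A set whose sections parallel to the subspace `V` have small diameter has small measure. -/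
theorem measure_mul_pow_le_of_thin {E : Type*} [NormedAddCommGroup E] [InnerProductSpace ℝ E]
    [FiniteDimensional ℝ E] [MeasurableSpace E] [BorelSpace E] (μ : Measure E)
    [μ.IsAddHaarMeasure] (V : Submodule ℝ E) {Ω K : Set E} (hΩ : MeasurableSet Ω)
    (hK : MeasurableSet K) {ρ d : ℝ} (hρ : 0 < ρ) (hd : 0 < d)
    (hΩK : ∀ x ∈ Ω, ∀ v ∈ V, ‖v‖ ≤ ρ → x - v ∈ K)
    (hthin : ∀ x ∈ Ω, ∀ y ∈ Ω, y - x ∈ V → ‖y - x‖ ≤ d) :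
    μ Ω * ENNReal.ofReal ((ρ / d) ^ finrank ℝ V) ≤ μ K := by
  set ν : Measure V := volume
  set B : Set V := Metric.closedBall 0 ρ with hB
  set B' : Set V := Metric.closedBall 0 d
  -- Fubini on this set of pairs: integrating over `x` first gives `μ Ω * ν B`; integrating over `v`
  -- first gives at most the volume of a ball of radius `d`, and only for `x ∈ K`.
  have hmeas : MeasurableSet {p : E × V | p.2 ∈ B ∧ p.1 + (p.2 : E) ∈ Ω} := by
    apply MeasurableSet.inter
    · exact measurable_snd Metric.isClosed_closedBall.measurableSet
    · exact (measurable_fst.add (measurable_subtype_coe.comp measurable_snd)) hΩ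
  have hmeas' : Measurable (Function.uncurry fun (x : E) (v : V) =>
      Set.indicator {p : E × V | p.2 ∈ B ∧ p.1 + (p.2 : E) ∈ Ω} (fun _ => (1 : ENNReal)) (x, v)) :=
    measurable_const.indicator hmeas
  have hswap := lintegral_lintegral_swap (μ := μ) (ν := ν) hmeas'.aemeasurable
  have hR : ∫⁻ v, ∫⁻ x, Set.indicator {p : E × V | p.2 ∈ B ∧ p.1 + (p.2 : E) ∈ Ω}
      (fun _ => (1 : ENNReal)) (x, v) ∂μ ∂ν = μ Ω * ν B := by
    have : ∀ v : V, ∫⁻ x, Set.indicator {p : E × V | p.2 ∈ B ∧ p.1 + (p.2 : E) ∈ Ω}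
        (fun _ => (1 : ENNReal)) (x, v) ∂μ = B.indicator (fun _ => μ Ω) v := by
      intro v
      by_cases hv : v ∈ B
      · rw [Set.indicator_of_mem hv, ← measure_preimage_add_right μ (v : E) Ω,
          ← lintegral_indicator_one (measurable_add_const (v : E) hΩ)]
        refine lintegral_congr fun x => ?_
        by_cases hx : x + (v : E) ∈ Ω <;> simp [Set.indicator, hv, hx]
      · rw [Set.indicator_of_notMem hv]
        simp [hv]
    simp_rw [this]
    rw [lintegral_indicator_const Metric.isClosed_closedBall.measurableSet]
  have hL : ∫⁻ x, ∫⁻ v, Set.indicator {p : E × V | p.2 ∈ B ∧ p.1 + (p.2 : E) ∈ Ω}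
      (fun _ => (1 : ENNReal)) (x, v) ∂ν ∂μ ≤ ν B' * μ K := by
    rw [← lintegral_indicator_const hK]
    refine lintegral_mono fun x => ?_
    by_cases hne : ∃ v : V, v ∈ B ∧ x + (v : E) ∈ Ω
    · obtain ⟨v₀, hv₀, hx⟩ := hne
      have hxK : x ∈ K := by
        have := hΩK _ hx v₀ v₀.2 (by simpa [hB] using hv₀)
        simpa using this
      rw [Set.indicator_of_mem hxK]
      have hset : MeasurableSet (Metric.closedBall v₀ d) := Metric.isClosed_closedBall.measurableSet
      calc _ ≤ ∫⁻ v, (Metric.closedBall v₀ d).indicator (fun _ => (1 : ENNReal)) v ∂ν := by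
            refine lintegral_mono fun v => ?_
            by_cases hv : v ∈ B ∧ x + (v : E) ∈ Ω
            · rw [Set.indicator_of_mem (by exact hv), Set.indicator_of_mem]
              rw [Metric.mem_closedBall, dist_eq_norm]
              have h := hthin _ hx _ hv.2
              rw [add_sub_add_left_eq_sub] at h
              exact h (V.sub_mem v.2 v₀.2)
            · rw [Set.indicator_of_notMem (by exact hv)]
              exact zero_le
        _ = ν (Metric.closedBall v₀ d) := by rw [lintegral_indicator_const hset, one_mul]
        _ = ν B' := by rw [Measure.addHaar_closedBall_center]
        _ ≤ _ := le_rfl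
    · push Not at hne
      have : ∀ v, Set.indicator {p : E × V | p.2 ∈ B ∧ p.1 + (p.2 : E) ∈ Ω}
        (fun _ => (1 : ENNReal)) (x, v) = 0 := fun v =>
        Set.indicator_of_notMem (fun h => hne v h.1 h.2) _
      simp [this]
  rw [hR] at hswap
  rw [hswap] at hL
  have hνB : ν B = ENNReal.ofReal ((ρ / d) ^ finrank ℝ V) * ν B' := by
    rw [Measure.addHaar_closedBall _ _ hρ.le, Measure.addHaar_closedBall _ _ hd.le, ← mul_assoc,
      ← ENNReal.ofReal_mul (by positivity), div_pow, div_mul_cancel₀ _ (by positivity)]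
  have h0 : ν B' ≠ 0 := (Metric.measure_closedBall_pos _ _ hd).ne'
  have hT : ν B' ≠ ⊤ := measure_closedBall_lt_top.ne
  rw [hνB, ← mul_assoc, mul_comm (ν B')] at hL
  exact (ENNReal.mul_le_mul_iff_left h0 hT).1 hL

/-! ### Operators near a multiple of the identity. -/

/-- An operator which maps each vector of a subspace close to a multiple of this vector is close
to a multiple of the identity on the subspace. -/
theorem exists_near_scalar_of_forall_exists {E : Type*} [NormedAddCommGroup E]
    [InnerProductSpace ℝ E] (P : E →ₗ[ℝ] E) {ε : ℝ} (hε : 0 ≤ ε) (H : Submodule ℝ E)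
    (h : ∀ x ∈ H, ∃ c : ℝ, ‖P x - c • x‖ ≤ ε * ‖x‖) :
    ∃ l : ℝ, ∀ x ∈ H, ‖P x - l • x‖ ≤ 6 * ε * ‖x‖ := by
  have horth : ∀ x ∈ H, ∀ w, inner ℝ w x = 0 → |inner ℝ w (P x)| ≤ ε * ‖x‖ * ‖w‖ := by
    intro x hx w hw
    obtain ⟨c, hc⟩ := h x hx
    have e : inner ℝ w (P x) = inner ℝ w (P x - c • x) := by
      rw [inner_sub_right, inner_smul_right, hw]; ring
    rw [e, mul_comm]
    exact (abs_real_inner_le_norm _ _).trans (by gcongr)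
  have hmin : ∀ x ∈ H, ‖x‖ = 1 → ‖P x - (inner ℝ x (P x) : ℝ) • x‖ ≤ ε := by
    intro x hx h1
    set w := P x - (inner ℝ x (P x) : ℝ) • x with hw
    have hxw : inner ℝ w x = 0 := by
      rw [hw, inner_sub_left, real_inner_smul_left, real_inner_self_eq_norm_sq, h1,
        real_inner_comm]
      ring
    have h2 := horth x hx w hxw
    have e : inner ℝ w (P x) = ‖w‖ ^ 2 := by
      have : P x = w + (inner ℝ x (P x) : ℝ) • x := by rw [hw]; abel
      rw [this, inner_add_right, inner_smul_right, hxw, real_inner_self_eq_norm_sq]; ring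
    rw [e, h1, mul_one, abs_of_nonneg (by positivity), sq] at h2
    rcases (norm_nonneg w).eq_or_lt with h0 | h0
    · rw [← h0]; exact hε
    · exact le_of_mul_le_mul_right h2 h0
  by_cases hH : ∃ x ∈ H, x ≠ 0
  · obtain ⟨x₁, hx₁, hne⟩ := hH
    obtain ⟨x₀, hx₀, hn⟩ : ∃ x₀ ∈ H, ‖x₀‖ = 1 :=
      ⟨‖x₁‖⁻¹ • x₁, H.smul_mem _ hx₁, by
        rw [norm_smul, norm_inv, norm_norm, inv_mul_cancel₀ (norm_ne_zero_iff.2 hne)]⟩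
    set l : ℝ := inner ℝ x₀ (P x₀) with hl
    have hunit : ∀ y ∈ H, ‖y‖ = 1 → inner ℝ x₀ y = 0 → ‖P y - l • y‖ ≤ 5 * ε := by
      intro y hy h1 hxy
      -- For orthonormal `x₀`, `y` the vectors `x₀ ± y` are orthogonal. Testing `P` on them compares
      -- the Rayleigh quotients at `x₀` and `y`: an error `2ε` here, and `ε` from each of the two
      -- cross terms.
      have h2 := horth (x₀ + y) (H.add_mem hx₀ hy) (x₀ - y) (by
        rw [inner_sub_left, inner_add_right, inner_add_right, real_inner_comm x₀ y,
          real_inner_self_eq_norm_sq, real_inner_self_eq_norm_sq, hn, h1]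
        ring)
      have h3 := horth x₀ hx₀ y (by rw [real_inner_comm]; exact hxy)
      have h4 := horth y hy x₀ hxy
      rw [hn, h1] at h3 h4
      have h5 : ε * ‖x₀ + y‖ * ‖x₀ - y‖ ≤ 2 * ε := by
        have hp := parallelogram_law_with_norm ℝ x₀ y
        rw [hn, h1] at hp
        have : ‖x₀ + y‖ * ‖x₀ - y‖ ≤ 2 := by nlinarith [sq_nonneg (‖x₀ + y‖ - ‖x₀ - y‖)]
        nlinarith
      rw [map_add, inner_sub_left, inner_add_right, inner_add_right, ← hl] at h2
      have h6 : |l - inner ℝ y (P y)| ≤ 4 * ε := by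
        rw [abs_le] at h2 h3 h4 ⊢
        constructor <;> linarith [h2.1, h2.2, h3.1, h3.2, h4.1, h4.2]
      calc ‖P y - l • y‖ = ‖(P y - (inner ℝ y (P y) : ℝ) • y) - (l - inner ℝ y (P y)) • y‖ := by
            congr 1; rw [sub_smul]; abel
        _ ≤ ‖P y - (inner ℝ y (P y) : ℝ) • y‖ + ‖(l - inner ℝ y (P y)) • y‖ := norm_sub_le _ _
        _ ≤ ε + 4 * ε := by
            rw [norm_smul, h1, mul_one]
            exact add_le_add (hmin y hy h1) h6
        _ = 5 * ε := by ring
    refine ⟨l, fun x hx => ?_⟩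
    set a : ℝ := inner ℝ x₀ x with ha
    set w := x - a • x₀ with hw
    have hwH : w ∈ H := H.sub_mem hx (H.smul_mem _ hx₀)
    have hwx : inner ℝ x₀ w = 0 := by
      rw [hw, inner_sub_right, inner_smul_right, real_inner_self_eq_norm_sq, hn, ← ha]; ring
    have hxe : x = a • x₀ + w := by rw [hw]; abel
    have hnorm : ‖x‖ ^ 2 = a ^ 2 + ‖w‖ ^ 2 := by
      rw [hxe, norm_add_sq_real, real_inner_smul_left, hwx, norm_smul, hn, Real.norm_eq_abs,
        mul_one, sq_abs]
      ring
    have hw5 : ‖P w - l • w‖ ≤ 5 * ε * ‖w‖ := by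
      rcases eq_or_ne w 0 with h0 | h0
      · simp [h0]
      have hw0 := norm_ne_zero_iff.2 h0
      have h7 := hunit (‖w‖⁻¹ • w) (H.smul_mem _ hwH)
        (by rw [norm_smul, norm_inv, norm_norm, inv_mul_cancel₀ hw0])
        (by rw [inner_smul_right, hwx, mul_zero])
      rw [map_smul, smul_comm, ← smul_sub, norm_smul, norm_inv, norm_norm, mul_comm] at h7
      rwa [← div_eq_mul_inv, div_le_iff₀ (norm_pos_iff.2 h0)] at h7
    have ha' : |a| ≤ ‖x‖ := abs_le_of_sq_le_sq (by nlinarith [sq_nonneg ‖w‖]) (norm_nonneg _)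
    have hw' : ‖w‖ ≤ ‖x‖ := (sq_le_sq₀ (norm_nonneg _) (norm_nonneg _)).1 (by nlinarith [sq_nonneg a])
    calc ‖P x - l • x‖ = ‖a • (P x₀ - l • x₀) + (P w - l • w)‖ := by
          congr 1
          have e1 : P x = a • P x₀ + P w := by rw [← map_smul, ← map_add, ← hxe]
          have e2 : l • x = l • a • x₀ + l • w := by rw [← smul_add, ← hxe]
          rw [e1, e2, smul_sub a (P x₀), smul_comm l a]
          abel
      _ ≤ |a| * ε + 5 * ε * ‖w‖ := by
          refine (norm_add_le _ _).trans (add_le_add ?_ hw5)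
          rw [norm_smul, Real.norm_eq_abs]
          gcongr
          exact hmin x₀ hx₀ hn
      _ ≤ ‖x‖ * ε + 5 * ε * ‖x‖ := by gcongr
      _ = 6 * ε * ‖x‖ := by ring
  · push Not at hH
    exact ⟨0, fun x hx => by simp [hH x hx]⟩

open Module in
/-- An operator on a Euclidean space is, on a subspace of small codimension, close to a multiple
of the identity, unless it moves a subspace of large dimension away from itself. -/
theorem exists_moved_submodule_or_near_scalar {E : Type*} [NormedAddCommGroup E]
    [InnerProductSpace ℝ E] [FiniteDimensional ℝ E] (P : E →ₗ[ℝ] E) {ε : ℝ} (hε : 0 ≤ ε) (k : ℕ) :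
    (∃ M : Submodule ℝ E, finrank ℝ M = k ∧
      ∀ e ∈ M, ∃ y ∈ Mᗮ, P e - y ∈ M ∧ ε * ‖e‖ ≤ ‖y‖) ∨
    (∃ (H : Submodule ℝ E) (l : ℝ), finrank ℝ E ≤ finrank ℝ H + 4 * k ∧
      ∀ x ∈ H, ‖P x - l • x‖ ≤ 6 * ε * ‖x‖) := by
  induction k with
  | zero => exact Or.inl ⟨⊥, by simp, fun e he => ⟨0, by simp, by simp_all, by simp_all⟩⟩
  | succ k ih =>
    rcases ih with ⟨M, hMk, hM⟩ | ⟨H, l, h1, h2⟩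
    swap
    · exact Or.inr ⟨H, l, by omega, h2⟩
    set Q := LinearMap.adjoint P with hQ
    -- If `x ⟂ C`, then `x` and, through the adjoint, `P x` are orthogonal to `M` and `P M`. So
    -- either all of `Cᗮ` is nearly scalar, or a bad vector of `Cᗮ` can be added to `M` without
    -- disturbing what was achieved.
    set C : Submodule ℝ E := (M ⊔ M.map P) ⊔ (M ⊔ M.map P).map Q with hC
    have hCdim : finrank ℝ C ≤ 4 * k := by
      have h1 : finrank ℝ (M ⊔ M.map P : Submodule ℝ E) ≤ 2 * k := by
        have := Submodule.finrank_add_le_finrank_add_finrank M (M.map P)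
        have := Submodule.finrank_map_le P M
        omega
      have := Submodule.finrank_add_le_finrank_add_finrank (M ⊔ M.map P) ((M ⊔ M.map P).map Q)
      have := Submodule.finrank_map_le Q (M ⊔ M.map P)
      rw [hC]
      omega
    by_cases hbad : ∀ x ∈ Cᗮ, ∃ c : ℝ, ‖P x - c • x‖ ≤ ε * ‖x‖
    · obtain ⟨l, hl⟩ := exists_near_scalar_of_forall_exists P hε Cᗮ hbad
      refine Or.inr ⟨Cᗮ, l, ?_, hl⟩
      have := Submodule.finrank_add_finrank_orthogonal C
      omega
    push Not at hbad
    obtain ⟨x, hxC, hx⟩ := hbad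
    have hx0 : x ≠ 0 := by
      rintro rfl
      simpa using hx 0
    have hxM : ∀ e ∈ M, inner ℝ e x = 0 := fun e he =>
      hxC e (Submodule.mem_sup_left (Submodule.mem_sup_left he))
    have hxPM : ∀ e ∈ M, inner ℝ (P e) x = 0 := fun e he =>
      hxC _ (Submodule.mem_sup_left (Submodule.mem_sup_right ⟨e, he, rfl⟩))
    have hPx : ∀ z ∈ M ⊔ M.map P, inner ℝ z (P x) = 0 := fun z hz => by
      rw [← LinearMap.adjoint_inner_left]
      exact hxC _ (Submodule.mem_sup_right ⟨z, hz, rfl⟩)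
    set c : ℝ := inner ℝ x (P x) / ‖x‖ ^ 2 with hc
    set w := P x - c • x with hw
    have hxw : inner ℝ x w = 0 := by
      rw [hw, inner_sub_right, inner_smul_right, real_inner_self_eq_norm_sq, hc,
        div_mul_cancel₀ _ (pow_ne_zero 2 (norm_ne_zero_iff.2 hx0)), sub_self]
    have hMP : ∀ z ∈ M ⊔ M.map P, inner ℝ z x = 0 := fun z hz => hxC z (Submodule.mem_sup_left hz)
    have hzw : ∀ z ∈ M ⊔ M.map P, inner ℝ z w = 0 := fun z hz => by
      rw [hw, inner_sub_right, inner_smul_right, hPx z hz, hMP z hz]; ring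
    have hxnM : x ∉ M := fun h => hx0 (inner_self_eq_zero.1 (hxM x h))
    refine Or.inl ⟨M ⊔ Submodule.span ℝ {x}, ?_, fun e' he' => ?_⟩
    · have h1 := Submodule.finrank_sup_add_finrank_inf_eq M (Submodule.span ℝ {x})
      have h2 : M ⊓ Submodule.span ℝ {x} = ⊥ := by
        rw [← disjoint_iff, Submodule.disjoint_span_singleton' hx0]
        exact hxnM
      rw [h2, finrank_bot, finrank_span_singleton hx0] at h1
      omega
    · obtain ⟨e, he, v, hv, rfl⟩ := Submodule.mem_sup.1 he'
      obtain ⟨a, rfl⟩ := Submodule.mem_span_singleton.1 hv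
      obtain ⟨y, hy, hyM, hyn⟩ := hM e he
      have hyMP : y ∈ M ⊔ M.map P := by
        have : y = P e - (P e - y) := by abel
        rw [this]
        exact Submodule.sub_mem _ (Submodule.mem_sup_right ⟨e, he, rfl⟩)
          (Submodule.mem_sup_left hyM)
      refine ⟨y + a • w, ?_, ?_, ?_⟩
      · rw [Submodule.mem_orthogonal]
        intro z hz
        obtain ⟨e₂, he₂, v₂, hv₂, rfl⟩ := Submodule.mem_sup.1 hz
        obtain ⟨b, rfl⟩ := Submodule.mem_span_singleton.1 hv₂
        rw [inner_add_left, inner_add_right, inner_add_right, real_inner_smul_left,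
          real_inner_smul_left, inner_smul_right, inner_smul_right, hy e₂ he₂, hxw,
          hzw e₂ (Submodule.mem_sup_left he₂), real_inner_comm, hMP y hyMP]
        ring
      · have : P (e + a • x) - (y + a • w) = (P e - y) + (a * c) • x := by
          rw [map_add, map_smul, hw, smul_sub, smul_smul]; abel
        rw [this]
        exact Submodule.add_mem_sup hyM
          (Submodule.smul_mem _ _ (Submodule.mem_span_singleton_self x))
      -- Both `e ⟂ x` and `y ⟂ w`, so the two lower bounds add in squares and `ε` does not
      -- deteriorate.
      · refine (sq_le_sq₀ (by positivity) (norm_nonneg _)).1 ?_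
        rw [mul_pow, norm_add_sq_real, norm_add_sq_real, inner_smul_right, inner_smul_right,
          hxM e he, hzw y hyMP, norm_smul, norm_smul]
        have h1 : (ε * ‖e‖) ^ 2 ≤ ‖y‖ ^ 2 := by gcongr
        have h2 : (ε * ‖x‖) ^ 2 ≤ ‖w‖ ^ 2 := by
          gcongr
          exact (hx c).le
        nlinarith [mul_le_mul_of_nonneg_left h2 (sq_nonneg ‖a‖)]

/-! ### The cube of tuples and its volume. -/

/-- The cube of all `m`-tuples of vectors in `ℝⁿ` with coordinates of size at most `n^{-1/2}`. -/
def coordCube (n m : ℕ) : Set (PiLp 2 fun _ : Fin m => Rn n) :=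
  {G | ∀ j i, |G j i| ≤ 1 / √n}

theorem isClosed_coordCube (n m : ℕ) : IsClosed (coordCube n m) := by
  simp only [coordCube, Set.ofPred_forall]
  refine isClosed_iInter fun j => isClosed_iInter fun i => isClosed_le ?_ continuous_const
  fun_prop

theorem norm_sq_eq_sum_sum {n m : ℕ} (G : PiLp 2 fun _ : Fin m => Rn n) :
    ‖G‖ ^ 2 = ∑ j, ∑ i, (G j i) ^ 2 := by
  rw [PiLp.norm_sq_eq_of_L2]
  refine Finset.sum_congr rfl fun j _ => ?_
  rw [EuclideanSpace.real_norm_sq_eq]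

theorem sq_coord_le_of_mem_coordCube {n m : ℕ} {G : PiLp 2 fun _ : Fin m => Rn n}
    (hG : G ∈ coordCube n m) (j : Fin m) (i : Fin n) : (G j i) ^ 2 ≤ 1 / n := by
  have h := hG j i
  have : (G j i) ^ 2 ≤ (1 / √n) ^ 2 := sq_le_sq' (neg_le_of_abs_le h) (le_of_abs_le h)
  rwa [div_pow, one_pow, Real.sq_sqrt (Nat.cast_nonneg n)] at this

theorem norm_apply_le_one_of_mem_coordCube {n m : ℕ} {G : PiLp 2 fun _ : Fin m => Rn n}
    (hG : G ∈ coordCube n m) (j : Fin m) : ‖G j‖ ≤ 1 := by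
  have : ‖G j‖ ^ 2 ≤ 1 := by
    rw [EuclideanSpace.real_norm_sq_eq]
    refine (Finset.sum_le_sum fun i _ => sq_coord_le_of_mem_coordCube hG j i).trans ?_
    simpa using mul_inv_le_one
  exact (sq_le_one_iff₀ (norm_nonneg _)).1 this

theorem norm_le_of_mem_coordCube {n m : ℕ} {G : PiLp 2 fun _ : Fin m => Rn n}
    (hG : G ∈ coordCube n m) : ‖G‖ ≤ √m := by
  refine Real.le_sqrt_of_sq_le ?_
  rw [PiLp.norm_sq_eq_of_L2]
  calc ∑ j, ‖G j‖ ^ 2 ≤ ∑ _j : Fin m, (1 : ℝ) := Finset.sum_le_sum fun j _ =>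
        (sq_le_one_iff₀ (norm_nonneg _)).2 (norm_apply_le_one_of_mem_coordCube hG j)
    _ = m := by simp

open MeasureTheory in
/-- The ball circumscribed to the cube, doubled, is covered by few translates of the cube. -/
theorem volume_closedBall_le_coordCube {n m : ℕ} (hn : 0 < n) :
    volume (Metric.closedBall (0 : PiLp 2 fun _ : Fin m => Rn n) (2 * √m)) ≤
      ENNReal.ofReal (24 ^ (m * n)) * volume (coordCube n m) := by
  -- On the ball of radius `2√m`, Cauchy-Schwarz bounds the `ℓ₁` norm of `√n x` by `2mn`, and
  -- rounding to the nearest integers adds at most `mn/2`. The count `2^(3mn) 3^(mn)` is `24^(mn)`.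
  obtain ⟨F, hF, hcard⟩ := exists_finset_int_l1_ball (Fin m × Fin n) (3 * (m * n))
  have hsn : (0 : ℝ) < √n := Real.sqrt_pos.2 (Nat.cast_pos.2 hn)
  set pt : (Fin m × Fin n → ℤ) → PiLp 2 fun _ : Fin m => Rn n := fun z =>
    WithLp.toLp 2 fun j => WithLp.toLp 2 fun i => (z (j, i) : ℝ) / √n with hpt
  have hcov : Metric.closedBall (0 : PiLp 2 fun _ : Fin m => Rn n) (2 * √m) ⊆
      ⋃ z ∈ F, (fun x => x + pt z) '' coordCube n m := by
    intro x hx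
    rw [mem_closedBall_zero_iff] at hx
    set z : Fin m × Fin n → ℤ := fun p => round (√n * x p.1 p.2) with hz
    have hround : ∀ p, |√n * x p.1 p.2 - z p| ≤ 1 / 2 := fun p => abs_sub_round _
    have hzF : z ∈ F := by
      refine hF z ?_
      have h1 : ∀ p, |(z p : ℝ)| ≤ √n * |x p.1 p.2| + 1 / 2 := fun p => by
        have e : (z p : ℝ) = √n * x p.1 p.2 - (√n * x p.1 p.2 - z p) := by ring
        rw [e]
        refine (abs_sub _ _).trans ?_
        rw [abs_mul, abs_of_pos hsn]
        exact add_le_add_right (hround p) _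
      have h2 : ∑ p : Fin m × Fin n, |x p.1 p.2| ≤ √(m * n) * ‖x‖ := by
        refine le_of_sq_le_sq ?_ (by positivity)
        have h := sq_sum_le_card_mul_sum_sq (s := (Finset.univ : Finset (Fin m × Fin n)))
          (f := fun p => |x p.1 p.2|)
        rw [mul_pow, Real.sq_sqrt (by positivity), norm_sq_eq_sum_sum, ← Fintype.sum_prod_type'
          (f := fun j i => (x j i) ^ 2)]
        simpa using h
      calc ∑ p, |(z p : ℝ)| ≤ ∑ p : Fin m × Fin n, (√n * |x p.1 p.2| + 1 / 2) :=
            Finset.sum_le_sum fun p _ => h1 p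
        _ = √n * (∑ p : Fin m × Fin n, |x p.1 p.2|) + (m * n) / 2 := by
            rw [Finset.sum_add_distrib, Finset.mul_sum]; simp; ring
        _ ≤ √n * (√(m * n) * (2 * √m)) + (m * n) / 2 := by
            gcongr
            exact h2.trans (by gcongr)
        _ = 2 * (√m * √m) * (√n * √n) + (m * n) / 2 := by
            rw [Real.sqrt_mul (Nat.cast_nonneg m)]; ring
        _ = 2 * m * n + (m * n) / 2 := by
            rw [Real.mul_self_sqrt (Nat.cast_nonneg m), Real.mul_self_sqrt (Nat.cast_nonneg n)]
        _ ≤ ((3 * (m * n) : ℕ) : ℝ) := by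
            push_cast
            have : (0 : ℝ) ≤ m * n := by positivity
            linarith
    refine Set.mem_biUnion hzF ⟨x - pt z, fun j i => ?_, by simp⟩
    have e : (x - pt z) j i = (√n * x j i - z (j, i)) / √n := by
      simp only [hpt, PiLp.sub_apply]
      field_simp
    rw [e, abs_div, abs_of_pos hsn]
    gcongr
    exact (hround (j, i)).trans (by norm_num)
  calc _ ≤ volume (⋃ z ∈ F, (fun x => x + pt z) '' coordCube n m) := measure_mono hcov
    _ ≤ ∑ z ∈ F, volume ((fun x => x + pt z) '' coordCube n m) := measure_biUnion_finset_le _ _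
    _ = (F.card : ENNReal) * volume (coordCube n m) := by
        simp
    _ ≤ _ := by
        gcongr
        rw [← ENNReal.ofReal_natCast]
        refine ENNReal.ofReal_le_ofReal (hcard.trans (le_of_eq ?_))
        rw [Fintype.card_prod, Fintype.card_fin, Fintype.card_fin, pow_mul, ← mul_pow]
        norm_num

open MeasureTheory in
theorem volume_coordCube_pos {n : ℕ} (hn : 0 < n) (m : ℕ) : 0 < volume (coordCube n m) := by
  have hsn : (0 : ℝ) < √n := Real.sqrt_pos.2 (Nat.cast_pos.2 hn)
  refine (Metric.measure_closedBall_pos volume (0 : PiLp 2 fun _ : Fin m => Rn n)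
    (one_div_pos.2 hsn)).trans_le (measure_mono fun G hG j i => ?_)
  rw [mem_closedBall_zero_iff] at hG
  exact (((PiLp.norm_apply_le (G j) i).trans (PiLp.norm_apply_le G j))).trans hG

open MeasureTheory in
theorem volume_coordCube_ne_top (n m : ℕ) : volume (coordCube n m) ≠ ⊤ :=
  ((measure_mono fun _ hG => mem_closedBall_zero_iff.2 (norm_le_of_mem_coordCube hG)).trans_lt
    (measure_closedBall_lt_top (x := (0 : PiLp 2 fun _ : Fin m => Rn n)) (r := √m))).ne

/-! ### The quadratic defect and the choice of the tuple. -/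

/-- The tuple of vectors `P g_j + ∑ᵢ (Q g_j)ᵢ gᵢ - ∑ᵢ A_{ji} gᵢ - B_j`. -/
noncomputable def quadDefect {n m : ℕ} (P : Rn n →ₗ[ℝ] Rn n) (Q : Rn n →ₗ[ℝ] (Fin m → ℝ))
    (A : Fin m → Fin m → ℝ) (B : Fin m → Rn n) (G : PiLp 2 fun _ : Fin m => Rn n) (j : Fin m) :
    Rn n :=
  P (G j) + ∑ i, Q (G j) i • G i - ∑ i, A j i • G i - B j

/-- The subspace `M` is moved by `P`: the component of `P e` orthogonal to `M` is large for all
vectors `e` in `M`. -/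
def IsMoved {E : Type*} [NormedAddCommGroup E] [InnerProductSpace ℝ E] (P : E →ₗ[ℝ] E) (ε : ℝ)
    (M : Submodule ℝ E) : Prop :=
  ∀ e ∈ M, ∃ y ∈ Mᗮ, P e - y ∈ M ∧ ε * ‖e‖ ≤ ‖y‖

open Module in
-- These tuples are the directions along which the exceptional sets are thin; their dimension is the
-- exponent of the volume gain.
theorem le_finrank_columns {n m : ℕ} (N : Submodule ℝ (Rn n)) :
    ∃ V : Submodule ℝ (PiLp 2 fun _ : Fin m => Rn n), (∀ D, D ∈ V ↔ ∀ j, D j ∈ N) ∧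
      m * finrank ℝ N ≤ finrank ℝ V := by
  let V : Submodule ℝ (PiLp 2 fun _ : Fin m => Rn n) :=
    { carrier := {D | ∀ j, D j ∈ N}
      add_mem' := fun ha hb j => N.add_mem (ha j) (hb j)
      zero_mem' := fun j => N.zero_mem
      smul_mem' := fun c x hx j => N.smul_mem c (hx j) }
  refine ⟨V, fun D => Iff.rfl, ?_⟩
  let f : (Fin m → N) →ₗ[ℝ] V :=
    { toFun := fun d => ⟨WithLp.toLp 2 fun j => (d j : Rn n), fun j => (d j).2⟩
      map_add' := fun a b => rfl
      map_smul' := fun c a => rfl }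
  have hf : Function.Injective f := fun a b h => by
    ext1 j
    have := congrArg (fun v : V => (v : PiLp 2 fun _ : Fin m => Rn n) j) h
    exact Subtype.ext this
  have := LinearMap.finrank_le_finrank_of_injective hf
  rwa [finrank_pi_fintype, Finset.sum_const, Finset.card_univ, Fintype.card_fin, smul_eq_mul]
    at this

open MeasureTheory Module in
/-- If `P` moves a subspace of dimension `2m`, then for few tuples is the quadratic defect small. -/
theorem volume_quadDefect_le {n m : ℕ} (P : Rn n →ₗ[ℝ] Rn n)
    (Q : Rn n →ₗ[ℝ] (Fin m → ℝ)) (A : Fin m → Fin m → ℝ) (B : Fin m → Rn n) {s : ℝ} (hs : 1 ≤ s)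
    (hm : 0 < m) {M : Submodule ℝ (Rn n)} (hMdim : finrank ℝ M = 2 * m)
    (hM : IsMoved P (8 * s / √m) M) :
    volume {G | G ∈ coordCube n m ∧ ∑ j, ‖quadDefect P Q A B G j‖ ^ 2 ≤ 16} *
      ENNReal.ofReal (s ^ (m ^ 2)) ≤
    volume (Metric.closedBall (0 : PiLp 2 fun _ : Fin m => Rn n) (2 * √m)) := by
  have hsm : (0 : ℝ) < √m := Real.sqrt_pos.2 (Nat.cast_pos.2 hm)
  set ε := 8 * s / √m with hε
  have hε0 : 0 < ε := by positivity
  -- Intersecting with `ker Q` costs at most `m` of the `2m` dimensions and makes the defect affine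
  -- along tuples with columns in `N`.
  set N := M ⊓ LinearMap.ker Q
  have hN : m ≤ finrank ℝ N := by
    have h1 := Submodule.finrank_sup_add_finrank_inf_eq M (LinearMap.ker Q)
    have h2 := LinearMap.finrank_range_add_finrank_ker Q
    have h3 : finrank ℝ (LinearMap.range Q) ≤ m := by
      simpa using Submodule.finrank_le (LinearMap.range Q)
    have h4 := Submodule.finrank_le (M ⊔ LinearMap.ker Q)
    change m ≤ finrank ℝ ↥(M ⊓ LinearMap.ker Q)
    omega
  obtain ⟨V, hV, hVdim⟩ := le_finrank_columns (m := m) N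
  have hVdim' : m ^ 2 ≤ finrank ℝ V := by nlinarith
  have hcont : ∀ j, Continuous fun G => quadDefect P Q A B G j := by
    intro j
    have hP := P.continuous_of_finiteDimensional
    have hQ := Q.continuous_of_finiteDimensional
    unfold quadDefect
    fun_prop
  have hmeas : MeasurableSet
      {G | G ∈ coordCube n m ∧ ∑ j, ‖quadDefect P Q A B G j‖ ^ 2 ≤ 16} := by
    have hcl : IsClosed {G | ∑ j, ‖quadDefect P Q A B G j‖ ^ 2 ≤ 16} :=
      isClosed_le (by fun_prop) continuous_const
    exact ((isClosed_coordCube n m).inter hcl).measurableSet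
  -- The cube lies in the ball of radius `√m`, so shifts by at most `√m` stay in the ball of radius
  -- `2√m`; sections have diameter at most `8/ε = √m/s`, and the ratio is `s`.
  have hthin := measure_mul_pow_le_of_thin volume V hmeas
    (K := Metric.closedBall 0 (2 * √m)) Metric.isClosed_closedBall.measurableSet hsm
    (d := 8 / ε) (by positivity) ?_ ?_
  · refine le_trans ?_ hthin
    gcongr
    have e : √m / (8 / ε) = s := by rw [hε]; field_simp
    rw [e]
    exact pow_le_pow_right₀ hs hVdim'
  · intro x hx v _ hv
    rw [mem_closedBall_zero_iff]
    have := norm_sub_le x v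
    have := norm_le_of_mem_coordCube hx.1
    linarith
  · intro x hx y hy hD
    set D := y - x with hDdef
    have hDj : ∀ j, y j = x j + D j := fun j => by simp [hDdef]
    rw [hV] at hD
    have hj : ∀ j, ε * ‖D j‖ ≤ ‖quadDefect P Q A B y j - quadDefect P Q A B x j‖ := by
      intro j
      obtain ⟨w, hw, hwM, hwn⟩ := hM (D j) (hD j).1
      -- Modulo `M` the change of the defect is just `w`, the part of `P (D j)` orthogonal to `M`:
      -- the remaining terms are combinations of the `D i ∈ M`.
      set u := (P (D j) - w) + ∑ i, Q (x j) i • D i - ∑ i, A j i • D i with hu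
      have huM : u ∈ M := by
        refine M.sub_mem (M.add_mem hwM ?_) ?_
        · exact M.sum_mem fun i _ => M.smul_mem _ (hD i).1
        · exact M.sum_mem fun i _ => M.smul_mem _ (hD i).1
      have hQD : Q (D j) = 0 := (hD j).2
      have e : quadDefect P Q A B y j - quadDefect P Q A B x j = u + w := by
        simp only [quadDefect, hDj, map_add, hQD, add_zero, smul_add, Finset.sum_add_distrib, hu]
        abel
      rw [e]
      refine hwn.trans (le_of_sq_le_sq ?_ (norm_nonneg _))
      rw [norm_add_sq_real, hw u huM]
      nlinarith [sq_nonneg ‖u‖]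
    have h1 : ε ^ 2 * ‖D‖ ^ 2 ≤ 64 := by
      rw [PiLp.norm_sq_eq_of_L2, Finset.mul_sum]
      calc ∑ j, ε ^ 2 * ‖D j‖ ^ 2 ≤ ∑ j, (2 * ‖quadDefect P Q A B y j‖ ^ 2 +
              2 * ‖quadDefect P Q A B x j‖ ^ 2) := by
            refine Finset.sum_le_sum fun j _ => ?_
            have h2 := (hj j).trans (norm_sub_le _ _)
            have h3 : (ε * ‖D j‖) ^ 2 ≤ (‖quadDefect P Q A B y j‖ + ‖quadDefect P Q A B x j‖) ^ 2 := by
              gcongr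
            nlinarith [sq_nonneg (‖quadDefect P Q A B y j‖ - ‖quadDefect P Q A B x j‖)]
        _ ≤ 64 := by
            rw [Finset.sum_add_distrib, ← Finset.mul_sum, ← Finset.mul_sum]
            linarith [hx.2, hy.2]
    rw [le_div_iff₀ hε0]
    refine le_of_sq_le_sq ?_ (by norm_num)
    nlinarith

/-- The operator on `ℝⁿ` whose `i`-th column is `∑ₐ n⁻¹ z(i, a) eₐ`. -/
noncomputable def gridOperator {n m : ℕ} (z : Fin n × (Fin n ⊕ Fin m) → ℤ) : Rn n →ₗ[ℝ] Rn n where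
  toFun x := WithLp.toLp 2 fun a => ∑ i, x i * (z (i, Sum.inl a) / n)
  map_add' x y := by
    ext a
    simp [add_mul, Finset.sum_add_distrib]
  map_smul' c x := by
    ext a
    simp [mul_assoc, Finset.mul_sum]

/-- The operator from `ℝⁿ` to `ℝᵐ` with the matrix entries `n⁻¹ z(i, j)`. -/
noncomputable def gridFunctionals {n m : ℕ} (z : Fin n × (Fin n ⊕ Fin m) → ℤ) :
    Rn n →ₗ[ℝ] (Fin m → ℝ) where
  toFun x := fun j => ∑ i, x i * (z (i, Sum.inr j) / n)
  map_add' x y := by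
    ext a
    simp [add_mul, Finset.sum_add_distrib]
  map_smul' c x := by
    ext a
    simp [mul_assoc, Finset.mul_sum]

/-- The quadratic defect for the grid operators given by two arrays of integers. -/
noncomputable def gridDefect {n m : ℕ} (z : Fin n × (Fin n ⊕ Fin m) → ℤ)
    (w : Fin m × (Fin n ⊕ Fin m) → ℤ) :
    (PiLp 2 fun _ : Fin m => Rn n) → Fin m → Rn n :=
  quadDefect (gridOperator z) (gridFunctionals z) (fun j i => (w (j, Sum.inr i) : ℝ) / n)
    (fun j => WithLp.toLp 2 fun a => (w (j, Sum.inl a) : ℝ) / n)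

open MeasureTheory Module in
/-- There is a tuple whose quadratic defect is large for all grid operators which move a subspace
of dimension `2m`. -/
theorem exists_tuple_gridDefect {n m : ℕ} (hm : 0 < m) (hmn : m ≤ n) {s : ℝ} (hs : 1 ≤ s)
    (hsn : (72 * 72 * 24 : ℝ) ^ (n ^ 2) < s ^ (m ^ 2)) :
    ∃ G ∈ coordCube n m, ∀ (z : Fin n × (Fin n ⊕ Fin m) → ℤ) (w : Fin m × (Fin n ⊕ Fin m) → ℤ),
      (∑ k, |(z k : ℝ)|) ≤ 3 * n ^ 2 → (∑ k, |(w k : ℝ)|) ≤ 3 * n ^ 2 →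
      (∃ M : Submodule ℝ (Rn n), finrank ℝ M = 2 * m ∧ IsMoved (gridOperator z) (8 * s / √m) M) →
      16 < ∑ j, ‖gridDefect z w G j‖ ^ 2 := by
  classical
  have hn : 0 < n := hm.trans_le hmn
  obtain ⟨F, hF, hFc⟩ := exists_finset_int_l1_ball (Fin n × (Fin n ⊕ Fin m)) (3 * n ^ 2)
  obtain ⟨F', hF', hFc'⟩ := exists_finset_int_l1_ball (Fin m × (Fin n ⊕ Fin m)) (3 * n ^ 2)
  have h72 : ∀ k ≤ 2 * n ^ 2, (2 : ℝ) ^ (3 * n ^ 2) * 3 ^ k ≤ 72 ^ n ^ 2 := by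
    intro k hk
    calc (2 : ℝ) ^ (3 * n ^ 2) * 3 ^ k ≤ 2 ^ (3 * n ^ 2) * 3 ^ (2 * n ^ 2) := by
          gcongr
          norm_num
      _ = 72 ^ n ^ 2 := by rw [pow_mul, pow_mul, ← mul_pow]; norm_num
  have hFc2 : (F.card : ℝ) ≤ 72 ^ n ^ 2 := by
    refine hFc.trans (h72 _ ?_)
    simp only [Fintype.card_prod, Fintype.card_sum, Fintype.card_fin]
    nlinarith
  have hFc2' : (F'.card : ℝ) ≤ 72 ^ n ^ 2 := by
    refine hFc'.trans (h72 _ ?_)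
    simp only [Fintype.card_prod, Fintype.card_sum, Fintype.card_fin]
    nlinarith
  set I := (F ×ˢ F').filter fun p =>
    ∃ M : Submodule ℝ (Rn n), finrank ℝ M = 2 * m ∧ IsMoved (gridOperator p.1) (8 * s / √m) M with hI
  set Ω : (Fin n × (Fin n ⊕ Fin m) → ℤ) × (Fin m × (Fin n ⊕ Fin m) → ℤ) →
    Set (PiLp 2 fun _ : Fin m => Rn n) := fun p =>
    {G | G ∈ coordCube n m ∧ ∑ j, ‖gridDefect p.1 p.2 G j‖ ^ 2 ≤ 16} with hΩ
  have hs0 : (0 : ℝ) < s ^ (m ^ 2) := by positivity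
  have hΩvol : ∀ p ∈ I, volume (Ω p) * ENNReal.ofReal (s ^ (m ^ 2)) ≤
      ENNReal.ofReal (24 ^ n ^ 2) * volume (coordCube n m) := by
    intro p hp
    obtain ⟨M, hMd, hM⟩ := (Finset.mem_filter.1 hp).2
    refine (volume_quadDefect_le _ _ _ _ hs hm hMd hM).trans
      ((volume_closedBall_le_coordCube hn).trans ?_)
    gcongr
    · norm_num
    · nlinarith
  have hcard : (I.card : ℝ) ≤ 72 ^ n ^ 2 * 72 ^ n ^ 2 := by
    have h1 : (I.card : ℝ) ≤ F.card * F'.card := by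
      have h2 : I.card ≤ F.card * F'.card :=
        (Finset.card_filter_le _ _).trans (Finset.card_product F F').le
      exact_mod_cast h2
    exact h1.trans (by gcongr)
  -- Union bound: a factor `72^(n²)`, with `72 = 2³·3²`, for each of the two integer arrays and
  -- `24^(n²)` for comparing the ball with the cube, against the gain `s^(m²)`.
  have hlt : volume (⋃ p ∈ I, Ω p) < volume (coordCube n m) := by
    by_contra hle
    push Not at hle
    have h1 : volume (coordCube n m) * ENNReal.ofReal (s ^ (m ^ 2)) ≤
        ENNReal.ofReal ((72 * 72 * 24) ^ n ^ 2) * volume (coordCube n m) := by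
      calc _ ≤ (∑ p ∈ I, volume (Ω p)) * ENNReal.ofReal (s ^ (m ^ 2)) := by
            gcongr
            exact hle.trans (measure_biUnion_finset_le _ _)
        _ = ∑ p ∈ I, volume (Ω p) * ENNReal.ofReal (s ^ (m ^ 2)) := Finset.sum_mul _ _ _
        _ ≤ ∑ p ∈ I, ENNReal.ofReal (24 ^ n ^ 2) * volume (coordCube n m) :=
            Finset.sum_le_sum hΩvol
        _ = ENNReal.ofReal (I.card * 24 ^ n ^ 2) * volume (coordCube n m) := by
            rw [Finset.sum_const, nsmul_eq_mul, ENNReal.ofReal_mul (Nat.cast_nonneg _),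
              ENNReal.ofReal_natCast, mul_assoc]
        _ ≤ _ := by
            gcongr
            rw [mul_pow, mul_pow]
            gcongr
    rw [mul_comm, ENNReal.mul_le_mul_iff_left (volume_coordCube_pos hn m).ne'
      (volume_coordCube_ne_top n m), ENNReal.ofReal_le_ofReal_iff (by positivity)] at h1
    exact absurd hsn (not_lt.2 h1)
  obtain ⟨G, hG, hGΩ⟩ : ∃ G ∈ coordCube n m, G ∉ ⋃ p ∈ I, Ω p := by
    by_contra hcon
    push Not at hcon
    exact absurd (measure_mono hcon) (not_le.2 hlt)
  refine ⟨G, hG, fun z w hz hw hM => ?_⟩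
  by_contra hle
  push Not at hle
  refine hGΩ (Set.mem_biUnion (x := (z, w)) ?_ ⟨hG, hle⟩)
  rw [hI, Finset.coe_filter]
  exact ⟨Finset.mem_product.2 ⟨hF z (by exact_mod_cast hz), hF' w (by exact_mod_cast hw)⟩, hM⟩

/-! ### Operators mapping the vertices into their absolutely convex hull. -/

open Module in
theorem finrank_add_finrank_le_inf {E : Type*} [AddCommGroup E] [Module ℝ E]
    [FiniteDimensional ℝ E] (A B : Submodule ℝ E) :
    finrank ℝ A + finrank ℝ B ≤ finrank ℝ (A ⊓ B : Submodule ℝ E) + finrank ℝ E := by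
  have h1 := Submodule.finrank_sup_add_finrank_inf_eq A B
  have h2 := Submodule.finrank_le (A ⊔ B)
  omega

/-- The unit vectors of `ℝⁿ` followed by the members of a tuple. -/
noncomputable def unitsAnd {n m : ℕ} (G : PiLp 2 fun _ : Fin m => Rn n) :
    Fin n ⊕ Fin m → Rn n :=
  Sum.elim (fun i => EuclideanSpace.single i 1) G

theorem norm_unitsAnd_le {n m : ℕ} {G : PiLp 2 fun _ : Fin m => Rn n}
    (hG : G ∈ coordCube n m) (k : Fin n ⊕ Fin m) : ‖unitsAnd G k‖ ≤ 1 := by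
  rcases k with i | j
  · simp [unitsAnd]
  · exact norm_apply_le_one_of_mem_coordCube hG j

/-- The reason for drawing the tuple from a cube: coordinates of size `n^{-1/2}` keep every row of
the vertex matrix bounded, which controls the rounding error simultaneously at all vertices. -/
theorem sum_unitsAnd_sq_le {n m : ℕ} (hm : 0 < m) (hmn : m ≤ n)
    {G : PiLp 2 fun _ : Fin m => Rn n} (hG : G ∈ coordCube n m) (i : Fin n) :
    ∑ q, (unitsAnd G q i) ^ 2 ≤ 2 := by
  have hn : (0 : ℝ) < n := Nat.cast_pos.2 (hm.trans_le hmn)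
  rw [Fintype.sum_sum_type]
  have h1 : ∑ a : Fin n, (unitsAnd G (Sum.inl a) i) ^ 2 = 1 := by
    simp [unitsAnd]
  have h2 : ∑ j : Fin m, (unitsAnd G (Sum.inr j) i) ^ 2 ≤ 1 := by
    refine (Finset.sum_le_sum fun j _ => sq_coord_le_of_mem_coordCube hG j i).trans ?_
    simp only [Finset.sum_const, Finset.card_univ, Fintype.card_fin, nsmul_eq_mul]
    rw [mul_one_div, div_le_one hn]
    exact_mod_cast hmn
  linarith

theorem gridOperator_add_eq {n m : ℕ} (z : Fin n × (Fin n ⊕ Fin m) → ℤ)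
    (G : PiLp 2 fun _ : Fin m => Rn n) (x : Rn n) :
    gridOperator z x + ∑ j, gridFunctionals z x j • G j =
      ∑ p : Fin n × (Fin n ⊕ Fin m), (x p.1 * (z p / n)) • unitsAnd G p.2 := by
  rw [Fintype.sum_prod_type]
  simp only [Fintype.sum_sum_type, Finset.sum_add_distrib]
  congr 1
  · ext a
    simp [gridOperator, unitsAnd, Finset.sum_apply, Pi.single_apply]
  · rw [Finset.sum_comm]
    refine Finset.sum_congr rfl fun j _ => ?_
    simp [gridFunctionals, unitsAnd, Finset.sum_smul]

open Module in
/-- If the quadratic defect of a tuple is large for all grid operators which move a subspace of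
dimension `2m`, then every operator which maps the unit vectors and the tuple into the absolutely
convex hull of all these vectors is close to a multiple of the identity on a large subspace. -/
theorem near_scalar_of_gridDefect {n m : ℕ} (hm : 0 < m) (hmn : m ≤ n) {s : ℝ} (hs : 1 ≤ s)
    {G : PiLp 2 fun _ : Fin m => Rn n} (hG : G ∈ coordCube n m)
    (hdef : ∀ (z : Fin n × (Fin n ⊕ Fin m) → ℤ) (w : Fin m × (Fin n ⊕ Fin m) → ℤ),
      (∑ k, |(z k : ℝ)|) ≤ 3 * n ^ 2 → (∑ k, |(w k : ℝ)|) ≤ 3 * n ^ 2 →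
      (∃ M : Submodule ℝ (Rn n), finrank ℝ M = 2 * m ∧
        IsMoved (gridOperator z) (8 * s / √m) M) →
      16 < ∑ j, ‖gridDefect z w G j‖ ^ 2)
    (T : Rn n →ₗ[ℝ] Rn n)
    (hT : ∀ q, ∃ u : Fin n ⊕ Fin m → ℝ, (∑ k, |u k|) ≤ 1 ∧
      T (unitsAnd G q) = ∑ k, u k • unitsAnd G k) :
    ∃ (l : ℝ) (H : Submodule ℝ (Rn n)),
      (n : ℝ) ≤ finrank ℝ H + 9 * m + n / 64 ∧
      ∀ x ∈ H, ‖T x - l • x‖ ≤ (48 * s / √m + 16 / √n) * ‖x‖ := by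
  have hn : 0 < n := hm.trans_le hmn
  have hn' : (0 : ℝ) < n := Nat.cast_pos.2 hn
  have hmn' : (m : ℝ) ≤ n := Nat.cast_le.2 hmn
  set f := unitsAnd G with hf
  choose u hu1 hu using hT
  -- The vector attached to a matrix entry records its effect on all vertices at once, so the
  -- rounding error is `n` times the tuple `(R (f q))_q`. Each vector has squared norm at most `2`
  -- and there are `n(n+m) ≤ 2n²` entries, whence `∑ ‖R (f q)‖² ≤ 4`.
  obtain ⟨z, hz, hzerr⟩ := exists_int_rounding (H := PiLp 2 fun _ : Fin n ⊕ Fin m => Rn n)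
    (Finset.univ : Finset (Fin n × (Fin n ⊕ Fin m)))
    (fun p => WithLp.toLp 2 fun q => f q p.1 • f p.2) (fun p => n * u (Sum.inl p.1) p.2)
  have hw : ∀ j : Fin m, ∃ w : Fin n ⊕ Fin m → ℤ, (∀ k, |(w k : ℝ)| ≤ |n * u (Sum.inr j) k| + 1) ∧
      ‖∑ k, (n * u (Sum.inr j) k - w k) • f k‖ ^ 2 ≤ ∑ k, ‖f k‖ ^ 2 := fun j =>
    exists_int_rounding Finset.univ f _
  choose w hw1 hwerr using hw
  set Tz : Rn n →ₗ[ℝ] Rn n := gridOperator z +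
    ∑ j, ((LinearMap.proj j ∘ₗ gridFunctionals z).smulRight (G j)) with hTz
  have hTzx : ∀ x, Tz x = gridOperator z x + ∑ j, gridFunctionals z x j • G j := fun x => by
    simp [hTz]
  set R := T - Tz with hR
  have hTx : ∀ x : Rn n, T x = ∑ p : Fin n × (Fin n ⊕ Fin m),
      (x p.1 * u (Sum.inl p.1) p.2) • f p.2 := by
    intro x
    have hx : x = ∑ i, x i • f (Sum.inl i) := by
      ext a
      simp [hf, unitsAnd, Pi.single_apply]
    conv_lhs => rw [hx]
    rw [map_sum, Fintype.sum_prod_type]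
    refine Finset.sum_congr rfl fun i _ => ?_
    rw [map_smul, hu, Finset.smul_sum]
    simp only [smul_smul]
  have hRx : ∀ x : Rn n, R x = (n : ℝ)⁻¹ • ∑ p : Fin n × (Fin n ⊕ Fin m),
      (n * u (Sum.inl p.1) p.2 - z p) • (x p.1 • f p.2) := by
    intro x
    rw [hR, LinearMap.sub_apply, hTx, hTzx, gridOperator_add_eq, ← Finset.sum_sub_distrib,
      Finset.smul_sum]
    refine Finset.sum_congr rfl fun p _ => ?_
    rw [← sub_smul, smul_smul, smul_smul]
    congr 1
    field_simp
  have hRf : ∑ q, ‖R (f q)‖ ^ 2 ≤ 4 := by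
    have e : ∑ q, ‖R (f q)‖ ^ 2 = ((n : ℝ)⁻¹) ^ 2 *
        ‖∑ p : Fin n × (Fin n ⊕ Fin m), ((n : ℝ) * u (Sum.inl p.1) p.2 - z p) •
          (WithLp.toLp 2 fun q => f q p.1 • f p.2 : PiLp 2 fun _ : Fin n ⊕ Fin m => Rn n)‖ ^ 2 := by
      rw [PiLp.norm_sq_eq_of_L2, Finset.mul_sum]
      refine Finset.sum_congr rfl fun q _ => ?_
      rw [hRx, norm_smul, mul_pow, Real.norm_eq_abs, sq_abs]
      simp
    rw [e]
    have h1 : ∀ p : Fin n × (Fin n ⊕ Fin m), ‖(WithLp.toLp 2 fun q => f q p.1 • f p.2 :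
        PiLp 2 fun _ : Fin n ⊕ Fin m => Rn n)‖ ^ 2 ≤ 2 := by
      intro p
      rw [PiLp.norm_sq_eq_of_L2]
      refine le_trans (Finset.sum_le_sum fun q _ => ?_) (sum_unitsAnd_sq_le hm hmn hG p.1)
      rw [norm_smul, mul_pow, Real.norm_eq_abs, sq_abs]
      exact mul_le_of_le_one_right (sq_nonneg _)
        ((sq_le_one_iff₀ (norm_nonneg _)).2 (norm_unitsAnd_le hG _))
    have h2 := hzerr.trans (Finset.sum_le_sum fun p _ => h1 p)
    simp only [Finset.sum_const, Finset.card_univ, Fintype.card_prod, Fintype.card_sum,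
      Fintype.card_fin, nsmul_eq_mul, Nat.cast_mul, Nat.cast_add] at h2
    rw [inv_pow, inv_mul_le_iff₀ (by positivity)]
    nlinarith
  have hzsum : ∑ k, |(z k : ℝ)| ≤ 3 * n ^ 2 := by
    calc ∑ k, |(z k : ℝ)| ≤ ∑ p : Fin n × (Fin n ⊕ Fin m), (n * |u (Sum.inl p.1) p.2| + 1) := by
          refine Finset.sum_le_sum fun p _ => (hz p).trans_eq ?_
          rw [abs_mul, Nat.abs_cast]
      _ = ∑ i : Fin n, n * (∑ k, |u (Sum.inl i) k|) + n * (n + m) := by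
          rw [Finset.sum_add_distrib, Fintype.sum_prod_type]
          simp only [Finset.mul_sum, Finset.sum_const, Finset.card_univ, Fintype.card_prod,
            Fintype.card_sum, Fintype.card_fin, nsmul_eq_mul, Nat.cast_mul, Nat.cast_add, mul_one]
      _ ≤ ∑ i : Fin n, (n : ℝ) * 1 + n * (n + m) := by
          gcongr with i
          exact hu1 _
      _ ≤ 3 * n ^ 2 := by
          simp only [Finset.sum_const, Finset.card_univ, Fintype.card_fin, nsmul_eq_mul]
          nlinarith
  have hwsum : ∑ k : Fin m × (Fin n ⊕ Fin m), |((w k.1 k.2 : ℤ) : ℝ)| ≤ 3 * n ^ 2 := by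
    calc ∑ k : Fin m × (Fin n ⊕ Fin m), |((w k.1 k.2 : ℤ) : ℝ)|
        ≤ ∑ p : Fin m × (Fin n ⊕ Fin m), (n * |u (Sum.inr p.1) p.2| + 1) := by
          refine Finset.sum_le_sum fun p _ => (hw1 p.1 p.2).trans_eq ?_
          rw [abs_mul, Nat.abs_cast]
      _ = ∑ i : Fin m, n * (∑ k, |u (Sum.inr i) k|) + m * (n + m) := by
          rw [Finset.sum_add_distrib, Fintype.sum_prod_type]
          simp only [Finset.mul_sum, Finset.sum_const, Finset.card_univ, Fintype.card_prod,
            Fintype.card_sum, Fintype.card_fin, nsmul_eq_mul, Nat.cast_mul, Nat.cast_add, mul_one]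
      _ ≤ ∑ i : Fin m, (n : ℝ) * 1 + m * (n + m) := by
          gcongr with i
          exact hu1 _
      _ ≤ 3 * n ^ 2 := by
          simp only [Finset.sum_const, Finset.card_univ, Fintype.card_fin, nsmul_eq_mul]
          nlinarith
  have hdefect : ∑ j, ‖gridDefect z (fun p => w p.1 p.2) G j‖ ^ 2 ≤ 16 := by
    have hj : ∀ j, ‖gridDefect z (fun p => w p.1 p.2) G j‖ ^ 2 ≤
        4 / n + 2 * ‖R (f (Sum.inr j))‖ ^ 2 := by
      intro j
      set a := (n : ℝ)⁻¹ • ∑ k, (n * u (Sum.inr j) k - w j k) • f k with ha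
      have hgj : f (Sum.inr j) = G j := rfl
      -- `T g_j` is expressed both through the rounded matrix and through its own rounded hull
      -- coefficients; the defect is the difference of the two rounding errors.
      have e : gridDefect z (fun p => w p.1 p.2) G j = a - R (f (Sum.inr j)) := by
        have e1 : a = T (f (Sum.inr j)) - ∑ k, ((w j k : ℝ) / n) • f k := by
          rw [ha, hu, ← Finset.sum_sub_distrib, Finset.smul_sum]
          refine Finset.sum_congr rfl fun k _ => ?_
          rw [← sub_smul, smul_smul]
          congr 1
          field_simp
        have e2 : ∑ k, ((w j k : ℝ) / n) • f k =
            WithLp.toLp 2 (fun a => (w j (Sum.inl a) : ℝ) / n) +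
            ∑ i, ((w j (Sum.inr i) : ℝ) / n) • G i := by
          rw [Fintype.sum_sum_type]
          congr 1
          ext a
          simp [hf, unitsAnd, Pi.single_apply]
        rw [e1, e2, hR, LinearMap.sub_apply, hTzx, hgj, gridDefect, quadDefect]
        abel
      have ha2 : ‖a‖ ^ 2 ≤ 2 / n := by
        rw [ha, norm_smul, mul_pow, norm_inv, Real.norm_natCast, inv_pow,
          inv_mul_le_iff₀ (by positivity)]
        refine (hwerr j).trans ?_
        have h1 : ∑ k, ‖f k‖ ^ 2 ≤ ∑ _k : Fin n ⊕ Fin m, (1 : ℝ) :=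
          Finset.sum_le_sum fun k _ =>
            (sq_le_one_iff₀ (norm_nonneg _)).2 (norm_unitsAnd_le hG _)
        simp only [Finset.sum_const, Finset.card_univ, Fintype.card_sum, Fintype.card_fin,
          nsmul_eq_mul, Nat.cast_add, mul_one] at h1
        have : (n : ℝ) ^ 2 * (2 / n) = 2 * n := by field_simp
        rw [this]
        linarith
      rw [e]
      have h2 := norm_sub_le a (R (f (Sum.inr j)))
      have h3 : ‖a - R (f (Sum.inr j))‖ ^ 2 ≤ (‖a‖ + ‖R (f (Sum.inr j))‖) ^ 2 := by gcongr
      have h4 : (4 : ℝ) / n = 2 * (2 / n) := by ring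
      rw [h4]
      nlinarith [sq_nonneg (‖a‖ - ‖R (f (Sum.inr j))‖)]
    refine (Finset.sum_le_sum fun j _ => hj j).trans ?_
    rw [Finset.sum_add_distrib, ← Finset.mul_sum]
    have h1 : ∑ j : Fin m, ‖R (f (Sum.inr j))‖ ^ 2 ≤ 4 := by
      rw [Fintype.sum_sum_type] at hRf
      have : 0 ≤ ∑ i : Fin n, ‖R (f (Sum.inl i))‖ ^ 2 := Finset.sum_nonneg fun _ _ => sq_nonneg _
      linarith
    have h2 : ∑ _j : Fin m, (4 : ℝ) / n ≤ 4 := by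
      simp only [Finset.sum_const, Finset.card_univ, Fintype.card_fin, nsmul_eq_mul]
      rw [mul_div_assoc', div_le_iff₀ hn']
      linarith
    linarith
  have hε : 0 ≤ 8 * s / √(m : ℝ) := by positivity
  rcases exists_moved_submodule_or_near_scalar (gridOperator z) hε (2 * m) with hM | ⟨H, l, hH, hHl⟩
  · exact absurd (hdef z _ hzsum hwsum hM) (not_lt.2 hdefect)
  -- With `t² = 256/n` and `K = 4` the codimension of `U` is at most `n/64`.
  obtain ⟨U, hU, hUR⟩ := exists_submodule_norm_le_of_sum_sq_le R (EuclideanSpace.basisFun (Fin n) ℝ)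
    (K := 4) (t := 16 / √n) (by
      refine le_trans ?_ hRf
      rw [Fintype.sum_sum_type]
      refine (le_add_of_nonneg_right (Finset.sum_nonneg fun _ _ => sq_nonneg _)).trans_eq' ?_
      simp [hf, unitsAnd]) (by positivity)
  set Q := gridFunctionals z
  refine ⟨l, H ⊓ LinearMap.ker Q ⊓ U, ?_, fun x hx => ?_⟩
  · have hQ : n ≤ finrank ℝ (LinearMap.ker Q) + m := by
      have h2 := LinearMap.finrank_range_add_finrank_ker Q
      have h3 : finrank ℝ (LinearMap.range Q) ≤ m := by
        simpa using Submodule.finrank_le (LinearMap.range Q)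
      rw [finrank_euclideanSpace_fin] at h2
      omega
    have hU' : (n : ℝ) ≤ finrank ℝ U + n / 64 := by
      rw [finrank_euclideanSpace_fin, div_pow, Real.sq_sqrt hn'.le, mul_div_assoc',
        div_le_iff₀ hn'] at hU
      linarith
    have h1 := finrank_add_finrank_le_inf H (LinearMap.ker Q)
    have h2 := finrank_add_finrank_le_inf (H ⊓ LinearMap.ker Q) U
    rw [finrank_euclideanSpace_fin] at h1 h2 hH
    have h3 : 2 * n + finrank ℝ U ≤ finrank ℝ ↥(H ⊓ LinearMap.ker Q ⊓ U) + 2 * n + 9 * m := by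
      omega
    have h4 : (2 * n + finrank ℝ U : ℝ) ≤
        finrank ℝ ↥(H ⊓ LinearMap.ker Q ⊓ U) + 2 * n + 9 * m := by exact_mod_cast h3
    linarith
  · have hQx : Q x = 0 := hx.1.2
    have e : T x - l • x = (gridOperator z x - l • x) + R x := by
      rw [hR, LinearMap.sub_apply, hTzx]
      have : ∑ j, gridFunctionals z x j • G j = 0 :=
        Finset.sum_eq_zero fun j _ => by rw [show gridFunctionals z x = 0 from hQx]; simp
      rw [this]
      abel
    rw [e, add_mul]
    refine (norm_add_le _ _).trans (add_le_add ?_ (hUR x hx.2))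
    refine (hHl x hx.1.1).trans_eq ?_
    ring

/-! ### Construction of Mankiewicz norms. -/

theorem NormOn.apply_le_opNorm {n : ℕ} (X : NormOn n) (T : Rn n →L[ℝ] Rn n) (x : Rn n) :
    X.toSeminorm (T x) ≤ ‖X.op T‖ * X.toSeminorm x := by
  have := (X.op T).le_opNorm (X.toSpace x)
  rwa [X.op_toSpace, X.norm_toSpace, X.norm_toSpace] at this

theorem NormOn.op_smul {n : ℕ} (X : NormOn n) (c : ℝ) (T : Rn n →L[ℝ] Rn n) :
    X.op (c • T) = c • X.op T := rfl

theorem NormOn.opNorm_eq_zero_iff {n : ℕ} (X : NormOn n) (T : Rn n →L[ℝ] Rn n) :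
    ‖X.op T‖ = 0 ↔ T = 0 := by
  constructor
  · intro h
    ext1 x
    have := X.apply_le_opNorm T x
    rw [h, zero_mul] at this
    exact X.eq_zero_of_toFun_eq_zero _ (le_antisymm this (apply_nonneg X.toSeminorm _))
  · rintro rfl
    have : X.op 0 = 0 := rfl
    rw [this, norm_zero]

theorem sum_abs_le_sqrt_mul_norm {n : ℕ} (x : Rn n) : ∑ i, |x i| ≤ √n * ‖x‖ := by
  refine le_of_sq_le_sq ?_ (by positivity)
  have h := sq_sum_le_card_mul_sum_sq (s := (Finset.univ : Finset (Fin n))) (f := fun i => |x i|)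
  rw [mul_pow, Real.sq_sqrt (Nat.cast_nonneg n), EuclideanSpace.real_norm_sq_eq]
  simpa using h

theorem natCast_rpow_neg_half (n : ℕ) : (n : ℝ) ^ (-1 / 2 : ℝ) = (√n)⁻¹ := by
  rw [neg_div, Real.rpow_neg (Nat.cast_nonneg n), Real.sqrt_eq_rpow]

/-- The quotient norm on `ℝⁿ` defined by a surjective contraction of `ℓ₁²ⁿ` onto `ℓ₂ⁿ`. -/
theorem exists_quotient_norm {n : ℕ} (Φ : (PiLp 1 fun _ : Fin (2 * n) => ℝ) →ₗ[ℝ] Rn n)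
    (hsurj : Function.Surjective Φ) (hΦ : ∀ u, ‖Φ u‖ ≤ ‖u‖) :
    ∃ X : NormOn n,
      Nonempty (((PiLp 1 fun _ : Fin (2 * n) => ℝ) ⧸ LinearMap.ker Φ) ≃ₗᵢ[ℝ] X.Space) ∧
      (∀ u, X.toSeminorm (Φ u) ≤ ‖u‖) ∧
      ∀ x r, X.toSeminorm x < r → ∃ u, Φ u = x ∧ ‖u‖ < r := by
  set e := Φ.quotKerEquivOfSurjective hsurj with he
  have hlift : ∀ x r, ‖e.symm x‖ < r → ∃ u, Φ u = x ∧ ‖u‖ < r := by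
    intro x r hr
    obtain ⟨u, hu, hur⟩ := Submodule.Quotient.norm_mk_lt (e.symm x) (sub_pos.2 hr)
    refine ⟨u, ?_, by linarith⟩
    rw [← e.apply_symm_apply x, ← hu]
    rfl
  let X : NormOn n :=
    { toFun := fun x => ‖e.symm x‖
      map_zero' := by simp
      add_le' := fun x y => by rw [map_add]; exact norm_add_le _ _
      neg' := fun x => by rw [map_neg, norm_neg]
      smul' := fun a x => by rw [map_smul, norm_smul]
      eq_zero_of_toFun_eq_zero := fun x hx => by
        by_contra hne
        obtain ⟨u, hu, hur⟩ := hlift x ‖x‖ (by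
          change ‖e.symm x‖ = 0 at hx
          rw [hx]
          exact norm_pos_iff.2 hne)
        exact absurd (hΦ u) (by rw [hu]; exact not_le.2 hur) }
  refine ⟨X, ⟨⟨e.trans X.toSpace, fun q => ?_⟩⟩, fun u => ?_, hlift⟩
  · change ‖e.symm (e q)‖ = ‖q‖
    rw [e.symm_apply_apply]
  · change ‖e.symm (Φ u)‖ ≤ ‖u‖
    have : e.symm (Φ u) = Submodule.Quotient.mk u := by
      rw [LinearEquiv.symm_apply_eq]; rfl
    rw [this]
    exact Submodule.Quotient.norm_mk_le _ _

/-- The norm on `ℝⁿ` whose unit ball is the absolutely convex hull of the unit vectors and of at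
most `n` further vectors of the Euclidean unit ball. -/
theorem exists_norm_unitsAnd {n m : ℕ} (hmn : m ≤ n) (G : PiLp 2 fun _ : Fin m => Rn n)
    (hG : ∀ k, ‖unitsAnd G k‖ ≤ 1) :
    ∃ X : NormOn n,
      (∃ S : Submodule ℝ (PiLp 1 fun _ : Fin (2 * n) => ℝ),
        Nonempty (((PiLp 1 fun _ : Fin (2 * n) => ℝ) ⧸ S) ≃ₗᵢ[ℝ] X.Space)) ∧
      (∀ x, ‖x‖ ≤ X.toSeminorm x) ∧ (∀ x, X.toSeminorm x ≤ ∑ i, |x i|) ∧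
      (∀ k, X.toSeminorm (unitsAnd G k) ≤ 1) ∧
      ∀ x, X.toSeminorm x < 1 → ∃ u : Fin n ⊕ Fin m → ℝ, (∑ k, |u k|) ≤ 1 ∧
        x = ∑ k, u k • unitsAnd G k := by
  classical
  obtain ⟨g⟩ : Nonempty ((Fin n ⊕ Fin m) ↪ Fin (2 * n)) :=
    Function.Embedding.nonempty_of_card_le (by simp; omega)
  -- Zero vectors pad the `n + m` vertices to exactly `2n`; they do not change the hull.
  set v : Fin (2 * n) → Rn n := Function.extend g (unitsAnd G) 0 with hv
  have hvg : ∀ q, v (g q) = unitsAnd G q := fun q => g.injective.extend_apply _ _ q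
  have hv0 : ∀ k, k ∉ Set.range g → v k = 0 := fun k hk => by
    rw [hv, Function.extend_apply' _ _ _ (by simpa using hk)]; rfl
  have hv1 : ∀ k, ‖v k‖ ≤ 1 := fun k => by
    by_cases hk : k ∈ Set.range g
    · obtain ⟨q, rfl⟩ := hk
      rw [hvg]
      exact hG q
    · simp [hv0 k hk]
  let Φ : (PiLp 1 fun _ : Fin (2 * n) => ℝ) →ₗ[ℝ] Rn n :=
    { toFun := fun u => ∑ k, u k • v k
      map_add' := fun a b => by simp [add_smul, Finset.sum_add_distrib]
      map_smul' := fun c a => by simp [Finset.smul_sum, smul_smul] }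
  have hΦv : ∀ u, Φ u = ∑ k, u k • v k := fun _ => rfl
  have hl1 : ∀ u : PiLp 1 fun _ : Fin (2 * n) => ℝ, ‖u‖ = ∑ k, |u k| := fun u => by
    rw [PiLp.norm_eq_of_L1]
    rfl
  have hsingle : ∀ k, Φ (PiLp.single 1 k 1) = v k := fun k => by
    rw [hΦv, Finset.sum_eq_single k] <;> simp +contextual
  have hnsingle : ∀ k, ‖(PiLp.single 1 k 1 : PiLp 1 fun _ : Fin (2 * n) => ℝ)‖ = 1 := fun k => by
    simp
  have hxsum : ∀ x : Rn n, x = ∑ i, x i • unitsAnd G (Sum.inl i) := fun x => by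
    ext a
    simp [unitsAnd, Pi.single_apply]
  have hsurj : Function.Surjective Φ := fun x => by
    refine ⟨∑ i, x i • PiLp.single 1 (g (Sum.inl i)) 1, ?_⟩
    rw [map_sum]
    conv_rhs => rw [hxsum x]
    refine Finset.sum_congr rfl fun i _ => ?_
    rw [map_smul, hsingle, hvg]
  have hΦ : ∀ u, ‖Φ u‖ ≤ ‖u‖ := fun u => by
    rw [hΦv, hl1]
    refine (norm_sum_le _ _).trans (Finset.sum_le_sum fun k _ => ?_)
    rw [norm_smul, Real.norm_eq_abs]
    exact mul_le_of_le_one_right (abs_nonneg _) (hv1 k)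
  obtain ⟨X, hX, hXle, hXlift⟩ := exists_quotient_norm Φ hsurj hΦ
  have hunit : ∀ q, X.toSeminorm (unitsAnd G q) ≤ 1 := fun q => by
    rw [← hvg, ← hsingle]
    exact (hXle _).trans_eq (hnsingle _)
  refine ⟨X, ⟨_, hX⟩, fun x => ?_, fun x => ?_, hunit, fun x hx => ?_⟩
  · refine le_of_forall_gt fun r hr => ?_
    obtain ⟨u, rfl, hu⟩ := hXlift x r hr
    exact (hΦ u).trans_lt hu
  · conv_lhs => rw [hxsum x]
    refine (Finset.le_sum_of_subadditive X.toSeminorm (map_zero X.toSeminorm).le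
      (map_add_le_add X.toSeminorm) _ _).trans (Finset.sum_le_sum fun i _ => ?_)
    rw [map_smul_eq_mul, Real.norm_eq_abs]
    exact mul_le_of_le_one_right (abs_nonneg _) (hunit _)
  · obtain ⟨u, rfl, hu⟩ := hXlift x 1 hx
    refine ⟨fun q => u (g q), ?_, ?_⟩
    · rw [hl1] at hu
      have h1 : ∑ q, |u (g q)| = ∑ k ∈ Finset.univ.map g, |u k| := by rw [Finset.sum_map]
      rw [h1]
      exact (Finset.sum_le_sum_of_subset_of_nonneg (Finset.subset_univ _)
        fun _ _ _ => abs_nonneg _).trans hu.le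
    · rw [hΦv]
      symm
      refine Fintype.sum_of_injective g g.injective _ _ (fun k hk => ?_) fun q => ?_
      · simp [hv0 k hk]
      · rw [hvg]

/-- A numerical base for which the volume gain beats the size of the grid of operators. -/
theorem exists_base_pow_lt (a : ℝ) (ha : 1 ≤ a) (C : ℕ) :
    ∃ s : ℝ, 1 ≤ s ∧ ∀ n m : ℕ, 0 < m → n ≤ C * m → a ^ (n ^ 2) < s ^ (m ^ 2) := by
  have h1 : 1 ≤ a ^ C ^ 2 := one_le_pow₀ ha
  refine ⟨a ^ (C ^ 2) + 1, by linarith, fun n m hm hnm => ?_⟩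
  calc a ^ (n ^ 2) ≤ a ^ (C ^ 2 * m ^ 2) := by
        refine pow_le_pow_right₀ ha ?_
        rw [← mul_pow]
        exact Nat.pow_le_pow_left hnm 2
    _ = (a ^ C ^ 2) ^ (m ^ 2) := pow_mul _ _ _
    _ < _ := pow_lt_pow_left₀ (by linarith) (by positivity) (by positivity)

open Module in
/-- Mankiewicz norms exist in all dimensions, with a uniform constant. -/
theorem exists_isMankiewiczNorm :
    ∃ c : ℝ, 0 < c ∧ ∀ n : ℕ, 2 ≤ n → ∃ X : NormOn n, IsMankiewiczNorm c X := by
  -- For `n ≥ 256`, `m = ⌊n/256⌋` satisfies `n ≤ 512 m`, hence also `√n ≤ 23 √m`, the source of `23`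
  -- in `c₀`.
  obtain ⟨s, hs, hsnm⟩ := exists_base_pow_lt (72 * 72 * 24) (by norm_num) 512
  set c₀ : ℝ := 48 * 23 * s + 16 with hc₀
  have hc₀0 : 0 < c₀ := by positivity
  -- The summand `256` settles `n < 256` trivially with `λ = 0` and `E = ℝⁿ`, since there `√n ≤
  -- 256/√n`. The rest is the bound `8 + c₀` for `|l|`, doubled by the later rescaling.
  refine ⟨256 + 2 * (8 + c₀), by positivity, fun n hn => ?_⟩
  have hn' : (0 : ℝ) < n := by positivity
  have hsn : (0 : ℝ) < √n := Real.sqrt_pos.2 hn'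
  rcases lt_or_ge n 256 with hsmall | hlarge
  · obtain ⟨X, hX1, hX2, hX3, -, -⟩ := exists_norm_unitsAnd (Nat.zero_le n)
      (0 : PiLp 2 fun _ : Fin 0 => Rn n) (by rintro (i | j) <;> [simp [unitsAnd]; exact j.elim0])
    refine ⟨X, hX1, hX2, hX3, fun T => ⟨0, ⊤, ?_, ?_, ?_⟩⟩
    · rw [finrank_top, finrank_euclideanSpace_fin]
      linarith
    · rw [abs_zero]
      positivity
    · refine ContinuousLinearMap.opNorm_le_bound _ (by positivity) fun x => ?_
      have h1 : ‖T x‖ ≤ ‖X.op T‖ * (√n * ‖(x : Rn n)‖) :=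
        (hX2 _).trans ((X.apply_le_opNorm T x).trans (by
          gcongr
          exact (hX3 _).trans (sum_abs_le_sqrt_mul_norm _)))
      have h2 : √(n : ℝ) ≤ (256 + 2 * (8 + c₀)) * (√n)⁻¹ := by
        rw [← div_eq_mul_inv, le_div_iff₀ hsn, Real.mul_self_sqrt hn'.le]
        have : (n : ℝ) < 256 := by exact_mod_cast hsmall
        linarith
      rw [natCast_rpow_neg_half]
      change ‖T x + (0 : ℝ) • (x : Rn n)‖ ≤ _
      rw [zero_smul, add_zero]
      calc ‖T x‖ ≤ ‖X.op T‖ * (√n * ‖(x : Rn n)‖) := h1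
        _ ≤ ‖X.op T‖ * (((256 + 2 * (8 + c₀)) * (√n)⁻¹) * ‖(x : Rn n)‖) := by gcongr
        _ = _ := by
          rw [← Submodule.coe_norm]
          ring
  · obtain ⟨m, hm⟩ : ∃ m, m = n / 256 := ⟨_, rfl⟩
    have hm0 : 0 < m := by omega
    have hmn : m ≤ n := by omega
    have hm512 : n ≤ 512 * m := by omega
    have hm256 : (256 * m : ℝ) ≤ n := by
      have : 256 * m ≤ n := by omega
      exact_mod_cast this
    obtain ⟨G, hG, hGdef⟩ := exists_tuple_gridDefect hm0 hmn hs (hsnm n m hm0 hm512)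
    obtain ⟨X, hX1, hX2, hX3, hX4, hX5⟩ := exists_norm_unitsAnd hmn G (norm_unitsAnd_le hG)
    have hrate : 48 * s / √m + 16 / √n ≤ c₀ * (√n)⁻¹ := by
      have hsm : (0 : ℝ) < √m := Real.sqrt_pos.2 (Nat.cast_pos.2 hm0)
      have h1 : √(n : ℝ) ≤ 23 * √m := by
        refine Real.sqrt_le_iff.2 ⟨by positivity, ?_⟩
        rw [mul_pow, Real.sq_sqrt (Nat.cast_nonneg m)]
        have : (n : ℝ) ≤ 512 * m := by exact_mod_cast hm512
        linarith
      have h2 : 48 * s / √m ≤ 48 * 23 * s / √n := by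
        rw [div_le_div_iff₀ hsm hsn]
        nlinarith
      calc _ ≤ 48 * 23 * s / √n + 16 / √n := by gcongr
        _ = _ := by rw [hc₀]; ring
    have hcontr : ∀ T : Rn n →L[ℝ] Rn n, ‖X.op T‖ < 1 → ∃ (l : ℝ) (E : Submodule ℝ (Rn n)),
        (7 * n / 8 : ℝ) < finrank ℝ E ∧ |l| ≤ 8 + c₀ ∧
          ∀ x ∈ E, ‖T x - l • x‖ ≤ c₀ * (√n)⁻¹ * ‖x‖ := by
      intro T hT
      have hTf : ∀ q, X.toSeminorm (T (unitsAnd G q)) < 1 := fun q =>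
        ((X.apply_le_opNorm T _).trans
          (mul_le_of_le_one_right (norm_nonneg _) (hX4 q))).trans_lt hT
      obtain ⟨l, H, hHdim, hHl⟩ := near_scalar_of_gridDefect hm0 hmn hs hG hGdef T.toLinearMap
        fun q => hX5 _ (hTf q)
      -- This subspace serves only to bound the scalar: `T` maps unit vectors into the Euclidean
      -- ball, so `‖Tx‖ ≤ 8‖x‖` off codimension `n/64`, and any nonzero vector of `H ⊓ U` then
      -- bounds `|l|`.
      obtain ⟨U, hU, hUT⟩ := exists_submodule_norm_le_of_sum_sq_le T.toLinearMap
        (EuclideanSpace.basisFun (Fin n) ℝ) (K := n) (t := 8) (by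
          have : ∀ i : Fin n, ‖T (EuclideanSpace.basisFun (Fin n) ℝ i)‖ ^ 2 ≤ 1 := fun i => by
            rw [sq_le_one_iff₀ (norm_nonneg _)]
            have := (hX2 _).trans (hTf (Sum.inl i)).le
            simpa [unitsAnd] using this
          simpa using Finset.sum_le_sum (s := Finset.univ) fun i _ => this i) (by norm_num)
      rw [finrank_euclideanSpace_fin] at hU
      have hinf := finrank_add_finrank_le_inf H U
      rw [finrank_euclideanSpace_fin] at hinf
      have hinf' : (finrank ℝ H + finrank ℝ U : ℝ) ≤ finrank ℝ ↥(H ⊓ U) + n := by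
        exact_mod_cast hinf
      have hdim : (7 * n / 8 : ℝ) < finrank ℝ ↥(H ⊓ U) := by linarith
      have hnear : ∀ x ∈ H ⊓ U, ‖T x - l • x‖ ≤ c₀ * (√n)⁻¹ * ‖x‖ := fun x hx =>
        (hHl x hx.1).trans (by gcongr)
      refine ⟨l, H ⊓ U, hdim, ?_, hnear⟩
      have hpos : 0 < finrank ℝ ↥(H ⊓ U) := by
        have : (0 : ℝ) < finrank ℝ ↥(H ⊓ U) := lt_of_le_of_lt (by positivity) hdim
        exact_mod_cast this
      obtain ⟨x, hx0⟩ := (finrank_pos_iff_exists_ne_zero (R := ℝ)).1 hpos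
      have hxn : 0 < ‖(x : Rn n)‖ := norm_pos_iff.2 fun h => hx0 (Subtype.ext h)
      refine le_of_mul_le_mul_right ?_ hxn
      have h1 : ‖T (x : Rn n)‖ ≤ 8 * ‖(x : Rn n)‖ := hUT x x.2.2
      have h2 := hnear x x.2
      have h3 : (√(n : ℝ))⁻¹ ≤ 1 := by
        refine inv_le_one_of_one_le₀ (Real.one_le_sqrt.2 ?_)
        exact_mod_cast (by omega : 1 ≤ n)
      calc |l| * ‖(x : Rn n)‖ = ‖T x - (T x - l • (x : Rn n))‖ := by
            rw [sub_sub_cancel, norm_smul, Real.norm_eq_abs]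
        _ ≤ 8 * ‖(x : Rn n)‖ + c₀ * (√n)⁻¹ * ‖(x : Rn n)‖ :=
            (norm_sub_le _ _).trans (add_le_add h1 h2)
        _ ≤ 8 * ‖(x : Rn n)‖ + c₀ * 1 * ‖(x : Rn n)‖ := by gcongr
        _ = (8 + c₀) * ‖(x : Rn n)‖ := by ring
    refine ⟨X, hX1, hX2, hX3, fun T => ?_⟩
    rcases eq_or_ne T 0 with rfl | hT
    · refine ⟨0, ⊤, ?_, ?_, ?_⟩
      · rw [finrank_top, finrank_euclideanSpace_fin]
        linarith
      · rw [abs_zero]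
        positivity
      · refine ContinuousLinearMap.opNorm_le_bound _ (by positivity) fun x => ?_
        change ‖(0 : Rn n) + (0 : ℝ) • (x : Rn n)‖ ≤ _
        rw [zero_smul, add_zero, norm_zero]
        positivity
    set τ := ‖X.op T‖ with hτ
    have hτ0 : 0 < τ := lt_of_le_of_ne (norm_nonneg _)
      fun h => hT ((X.opNorm_eq_zero_iff T).1 h.symm)
    -- Dividing by `2τ` rather than `τ` makes the norm strictly less than `1`, as needed to write
    -- images of vertices as hull elements.
    obtain ⟨l, E, hE, hl, hEl⟩ := hcontr ((2 * τ)⁻¹ • T) (by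
      rw [X.op_smul, norm_smul, norm_inv, Real.norm_of_nonneg (by positivity), ← hτ]
      field_simp
      norm_num)
    refine ⟨-(2 * τ * l), E, hE, ?_, ?_⟩
    · rw [abs_neg, abs_mul, abs_of_pos (by positivity)]
      nlinarith
    · refine ContinuousLinearMap.opNorm_le_bound _ (by positivity) fun x => ?_
      have h1 := hEl x x.2
      rw [natCast_rpow_neg_half]
      have e : (T + (-(2 * τ * l)) • ContinuousLinearMap.id ℝ (Rn n)).comp E.subtypeL x =
          (2 * τ) • (((2 * τ)⁻¹ • T) (x : Rn n) - l • (x : Rn n)) := by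
        simp only [ContinuousLinearMap.comp_apply, add_apply,
          smul_apply, Submodule.subtypeL_apply, ContinuousLinearMap.id_apply]
        rw [smul_sub, smul_smul, smul_smul, mul_inv_cancel₀ (by positivity), one_smul, neg_smul]
        abel
      rw [e, norm_smul, Real.norm_of_nonneg (by positivity)]
      calc 2 * τ * ‖((2 * τ)⁻¹ • T) (x : Rn n) - l • (x : Rn n)‖
          ≤ 2 * τ * (c₀ * (√n)⁻¹ * ‖(x : Rn n)‖) := by gcongr
        _ = (2 * c₀) * (√n)⁻¹ * τ * ‖x‖ := by rw [← Submodule.coe_norm]; ring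
        _ ≤ (256 + 2 * (8 + c₀)) * (√n)⁻¹ * τ * ‖x‖ := by
            gcongr
            linarith

/-! ### Sections of small Euclidean diameter in quotients of `ℓ₁²ⁿ`. -/

/-- The images of the unit vectors of `ℓ₁²ⁿ` under a quotient map. -/
theorem exists_vertices {n : ℕ} (X : NormOn n)
    (hX : ∃ S : Submodule ℝ (PiLp 1 fun _ : Fin (2 * n) => ℝ),
      Nonempty (((PiLp 1 fun _ : Fin (2 * n) => ℝ) ⧸ S) ≃ₗᵢ[ℝ] X.Space)) :
    ∃ v : Fin (2 * n) → Rn n, (∀ k, X.toSeminorm (v k) ≤ 1) ∧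
      ∀ x, X.toSeminorm x < 1 → ∃ u : Fin (2 * n) → ℝ, (∑ k, |u k|) ≤ 1 ∧
        x = ∑ k, u k • v k := by
  classical
  obtain ⟨S, ⟨φ⟩⟩ := hX
  let q : (PiLp 1 fun _ : Fin (2 * n) => ℝ) →ₗ[ℝ] Rn n :=
    X.toSpace.symm.toLinearMap ∘ₗ φ.toLinearEquiv.toLinearMap ∘ₗ S.mkQ
  have hq : ∀ u, X.toSeminorm (q u) ≤ ‖u‖ := fun u => by
    have h1 : X.toSeminorm (q u) = ‖φ (S.mkQ u)‖ := rfl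
    rw [h1, φ.norm_map]
    exact Submodule.Quotient.norm_mk_le _ _
  refine ⟨fun k => q (PiLp.single 1 k 1), fun k => (hq _).trans_eq (by simp), fun x hx => ?_⟩
  have hx' : ‖φ.symm (X.toSpace x)‖ < 1 := by rwa [φ.symm.norm_map]
  obtain ⟨u, hu, hu1⟩ := Submodule.Quotient.norm_mk_lt (φ.symm (X.toSpace x)) (sub_pos.2 hx')
  refine ⟨fun k => u k, ?_, ?_⟩
  · rw [PiLp.norm_eq_of_L1] at hu1
    simp only [Real.norm_eq_abs] at hu1
    linarith
  · have h1 : q u = x := by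
      change X.toSpace.symm (φ (Submodule.Quotient.mk u)) = x
      rw [hu, φ.apply_symm_apply, LinearEquiv.symm_apply_apply]
    have h2 : u = ∑ k, u k • PiLp.single 1 k (1 : ℝ) := by
      ext a
      simp [Pi.single_apply]
    rw [← h1]
    conv_lhs => rw [h2]
    rw [map_sum]
    simp only [map_smul]

/-- Enlarging the squared radius from `k` to `k + 3` in dimension `kn` costs only `27^n`, because
`(1 + 3/k)^k ≤ e³`. -/
theorem sqrt_add_three_pow_le {k : ℕ} (hk : 0 < k) (n : ℕ) :
    √((k : ℝ) + 3) ^ (k * n) ≤ 27 ^ n * √(k : ℝ) ^ (k * n) := by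
  have hk' : (0 : ℝ) < k := Nat.cast_pos.2 hk
  have h1 : √((k : ℝ) + 3) ≤ √k * (1 + 3 / k) := by
    refine Real.sqrt_le_iff.2 ⟨by positivity, ?_⟩
    rw [mul_pow, Real.sq_sqrt hk'.le]
    have : (k : ℝ) * (1 + 3 / k) ^ 2 = (k + 3) * (1 + 3 / k) := by field_simp
    rw [this]
    have : 0 ≤ 3 / (k : ℝ) := by positivity
    nlinarith
  have h2 : (1 + 3 / (k : ℝ)) ^ k ≤ 27 := by
    have h3 : 1 + 3 / (k : ℝ) ≤ Real.exp (3 / k) := by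
      have := Real.add_one_le_exp (3 / (k : ℝ))
      linarith
    calc (1 + 3 / (k : ℝ)) ^ k ≤ Real.exp (3 / k) ^ k := by gcongr
      _ = Real.exp 1 ^ 3 := by
        rw [← Real.exp_nat_mul, ← Real.exp_nat_mul]
        congr 1
        field_simp
        norm_num
      _ ≤ 3 ^ 3 := by
        gcongr
        exact Real.exp_one_lt_three.le
      _ = 27 := by norm_num
  calc √((k : ℝ) + 3) ^ (k * n) ≤ (√k * (1 + 3 / k)) ^ (k * n) := by gcongr
    _ = ((1 + 3 / (k : ℝ)) ^ k) ^ n * √(k : ℝ) ^ (k * n) := by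
        rw [mul_pow, pow_mul (1 + 3 / (k : ℝ))]; ring
    _ ≤ _ := by gcongr

open MeasureTheory Module in
/-- Few of the `k`-tuples of functionals in a Euclidean ball are small at a given vector. -/
theorem volume_small_at_le {n k : ℕ} (hk : 0 < k) {y : Rn n} (hy : 1 / 2 ≤ ‖y‖) {S : ℝ}
    (hS : 1 ≤ S) :
    volume {M : PiLp 2 fun _ : Fin k => Rn n | M ∈ Metric.closedBall 0 √k ∧
      ∑ a, inner ℝ (M a) y ^ 2 ≤ (1 / (4 * S)) ^ 2} * ENNReal.ofReal (S ^ k) ≤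
    ENNReal.ofReal (27 ^ n) * volume (Metric.closedBall (0 : PiLp 2 fun _ : Fin k => Rn n) √k) := by
  have hS0 : 0 < S := by linarith
  have hy0 : 0 < ‖y‖ := by linarith
  have hy2 : 1 / 4 ≤ ‖y‖ ^ 2 := by nlinarith
  have hτ : (1 / (4 * S)) ^ 2 ≤ 1 / 16 := by
    rw [div_pow, mul_pow, one_pow, div_le_div_iff₀ (by positivity) (by norm_num)]
    nlinarith
  obtain ⟨V, hV, hVdim⟩ := le_finrank_columns (m := k) (Submodule.span ℝ {y})
  rw [finrank_span_singleton (norm_pos_iff.1 hy0), mul_one] at hVdim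
  set Ω := {M : PiLp 2 fun _ : Fin k => Rn n | M ∈ Metric.closedBall 0 √k ∧
      ∑ a, inner ℝ (M a) y ^ 2 ≤ (1 / (4 * S)) ^ 2} with hΩ
  have hmeas : MeasurableSet Ω := by
    have hcl : IsClosed {M : PiLp 2 fun _ : Fin k => Rn n |
        ∑ a, inner ℝ (M a) y ^ 2 ≤ (1 / (4 * S)) ^ 2} :=
      isClosed_le (by fun_prop) continuous_const
    exact (Metric.isClosed_closedBall.inter hcl).measurableSet
  -- Tuples in `Ω` are nearly orthogonal to `V`, so a shift by at most `1` along `V` raises the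
  -- squared norm by at most `3`; the triangle inequality alone would give a radius too large for an
  -- `exp(O(n))` loss.
  have hthin := measure_mul_pow_le_of_thin volume V hmeas
    (K := Metric.closedBall 0 √((k : ℝ) + 3)) Metric.isClosed_closedBall.measurableSet one_pos
    (d := 1 / S) (by positivity) ?_ ?_
  · refine le_trans ?_ (hthin.trans ?_)
    · gcongr
      rw [one_div_one_div]
      exact pow_le_pow_right₀ hS hVdim
    · rw [Measure.addHaar_closedBall _ _ (Real.sqrt_nonneg _),
        Measure.addHaar_closedBall _ _ (Real.sqrt_nonneg _), ← mul_assoc,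
        ← ENNReal.ofReal_mul (by positivity)]
      gcongr
      have hdim : finrank ℝ (PiLp 2 fun _ : Fin k => Rn n) = k * n := by
        rw [(WithLp.linearEquiv 2 ℝ (Fin k → Rn n)).finrank_eq, finrank_pi_fintype]
        simp
      rw [hdim]
      exact sqrt_add_three_pow_le hk n
  · intro x hx v hv hv1
    rw [hV] at hv
    choose w hw using fun a => Submodule.mem_span_singleton.1 (hv a)
    rw [mem_closedBall_zero_iff]
    have hx1 : ‖x‖ ^ 2 ≤ k := by
      have := mem_closedBall_zero_iff.1 hx.1
      rwa [Real.le_sqrt (norm_nonneg _) (Nat.cast_nonneg k)] at this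
    have hv2 : ‖v‖ ^ 2 = (∑ a, w a ^ 2) * ‖y‖ ^ 2 := by
      rw [PiLp.norm_sq_eq_of_L2, Finset.sum_mul]
      refine Finset.sum_congr rfl fun a _ => ?_
      rw [← hw a, norm_smul, mul_pow, Real.norm_eq_abs, sq_abs]
    have hv3 : ‖v‖ ^ 2 ≤ 1 := (sq_le_one_iff₀ (norm_nonneg _)).2 hv1
    have hwsum : ∑ a, w a ^ 2 ≤ 4 := by
      have : 0 ≤ ∑ a, w a ^ 2 := Finset.sum_nonneg fun _ _ => sq_nonneg _
      nlinarith
    have hin : -(2 * inner ℝ x v) ≤ (∑ a, w a ^ 2) / 4 + 4 * ∑ a, inner ℝ (x a) y ^ 2 := by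
      rw [PiLp.inner_apply, Finset.mul_sum, Finset.mul_sum, Finset.sum_div,
        ← Finset.sum_add_distrib, ← Finset.sum_neg_distrib]
      refine Finset.sum_le_sum fun a _ => ?_
      rw [← hw a, inner_smul_right]
      nlinarith [sq_nonneg (w a / 2 + 2 * inner ℝ (x a) y)]
    refine Real.le_sqrt_of_sq_le ?_
    rw [norm_sub_sq_real]
    linarith [hx.2]
  · intro x hx z hz hD
    rw [hV] at hD
    set D := z - x with hDdef
    choose w hw using fun a => Submodule.mem_span_singleton.1 (hD a)
    have h1 : ∀ a, w a * ‖y‖ ^ 2 = inner ℝ (z a) y - inner ℝ (x a) y := fun a => by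
      rw [← inner_sub_left, ← real_inner_self_eq_norm_sq, ← real_inner_smul_left, hw a]
      simp [hDdef]
    have h2 : ‖D‖ ^ 2 * ‖y‖ ^ 2 ≤ 4 * (1 / (4 * S)) ^ 2 := by
      rw [PiLp.norm_sq_eq_of_L2, Finset.sum_mul]
      calc ∑ a, ‖D a‖ ^ 2 * ‖y‖ ^ 2
          ≤ ∑ a, (2 * inner ℝ (z a) y ^ 2 + 2 * inner ℝ (x a) y ^ 2) := by
            refine Finset.sum_le_sum fun a _ => ?_
            have : ‖D a‖ ^ 2 * ‖y‖ ^ 2 = (w a * ‖y‖ ^ 2) ^ 2 := by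
              rw [← hw a, norm_smul, mul_pow, Real.norm_eq_abs, sq_abs]; ring
            rw [this, h1]
            nlinarith [sq_nonneg (inner ℝ (z a) y + inner ℝ (x a) y)]
        _ ≤ _ := by
            rw [Finset.sum_add_distrib, ← Finset.mul_sum, ← Finset.mul_sum]
            linarith [hx.2, hz.2]
    refine le_of_sq_le_sq ?_ (by positivity)
    have h3 : 4 * (1 / (4 * S)) ^ 2 = (1 / S) ^ 2 * (1 / 4) := by
      field_simp
    rw [h3] at h2
    nlinarith [sq_nonneg ‖D‖, sq_nonneg (1 / S)]

open MeasureTheory Module in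
/-- The absolutely convex hull of `2n` vectors of the Euclidean unit ball of `ℝⁿ` has a section of
large dimension and of diameter of order `n^{-1/2}`. -/
theorem exists_small_section {n : ℕ} (hn : 16 ≤ n) {S : ℝ} (hS : 1 ≤ S)
    (hSn : (1944 : ℝ) ^ n < S ^ (n / 16)) (v : Fin (2 * n) → Rn n) (hv : ∀ j, ‖v j‖ ≤ 1) :
    ∃ Z : Submodule ℝ (Rn n), (n : ℝ) ≤ finrank ℝ Z + n / 8 ∧
      ∀ x ∈ Z, ∀ u : Fin (2 * n) → ℝ, (∑ j, |u j|) ≤ 1 → x = ∑ j, u j • v j →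
        √n * ‖x‖ ≤ 12 * S := by
  classical
  have hn' : (0 : ℝ) < n := by
    have : 0 < n := by omega
    exact_mod_cast this
  have hsn : (0 : ℝ) < √n := Real.sqrt_pos.2 hn'
  have hS0 : 0 < S := by linarith
  obtain ⟨k, hk⟩ : ∃ k, k = n / 16 := ⟨_, rfl⟩
  have hk0 : 0 < k := by omega
  have hk16 : (16 * k : ℝ) ≤ n := by
    have : 16 * k ≤ n := by omega
    exact_mod_cast this
  rw [← hk] at hSn
  let Ψ : Rn n →ₗ[ℝ] Rn (2 * n) :=
    { toFun := fun x => WithLp.toLp 2 fun j => inner ℝ (v j) x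
      map_add' := fun x y => by ext j; simp [inner_add_right]
      map_smul' := fun c x => by ext j; simp [inner_smul_right] }
  have hΨ : ∀ x, ‖Ψ x‖ ^ 2 = ∑ j, inner ℝ (v j) x ^ 2 := fun x => by
    rw [EuclideanSpace.real_norm_sq_eq]; rfl
  -- On `F`, of codimension at most `n/18`, `Ψ` is bounded by `6`. This bounds `∑ ⟨M a, p j⟩²` by
  -- `36k ≤ 3n` for every tuple `M` in the ball. With `k ≤ n/16` further functionals the total
  -- codimension is below `n/8`.
  obtain ⟨F, hF, hFΨ⟩ := exists_submodule_norm_le_of_sum_sq_le Ψ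
    (EuclideanSpace.basisFun (Fin n) ℝ) (K := 2 * n) (t := 6) (by
      simp_rw [hΨ]
      rw [Finset.sum_comm]
      have : ∀ j, ∑ i, inner ℝ (v j) (EuclideanSpace.basisFun (Fin n) ℝ i) ^ 2 ≤ 1 := fun j => by
        rw [(EuclideanSpace.basisFun (Fin n) ℝ).sum_sq_inner_left]
        exact (sq_le_one_iff₀ (norm_nonneg _)).2 (hv j)
      simpa using Finset.sum_le_sum (s := Finset.univ) fun j _ => this j) (by norm_num)
  rw [finrank_euclideanSpace_fin] at hF
  set p : Fin (2 * n) → Rn n := fun j => F.starProjection (v j) with hp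
  have hp1 : ∀ j, ‖p j‖ ≤ 1 := fun j => (F.norm_starProjection_apply_le _).trans (hv j)
  have hMp : ∀ M : PiLp 2 fun _ : Fin k => Rn n, M ∈ Metric.closedBall 0 √k →
      ∑ j, ∑ a, inner ℝ (M a) (p j) ^ 2 ≤ 3 * n := by
    intro M hM
    have hM1 : ∑ a, ‖M a‖ ^ 2 ≤ k := by
      have := mem_closedBall_zero_iff.1 hM
      rwa [Real.le_sqrt (norm_nonneg _) (Nat.cast_nonneg k), PiLp.norm_sq_eq_of_L2] at this
    rw [Finset.sum_comm]
    calc ∑ a, ∑ j, inner ℝ (M a) (p j) ^ 2 ≤ ∑ a, 36 * ‖M a‖ ^ 2 := by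
          refine Finset.sum_le_sum fun a _ => ?_
          have e : ∑ j, inner ℝ (M a) (p j) ^ 2 = ‖Ψ (F.starProjection (M a))‖ ^ 2 := by
            rw [hΨ]
            refine Finset.sum_congr rfl fun j _ => ?_
            rw [hp, ← F.inner_starProjection_left_eq_right, real_inner_comm]
          rw [e]
          have h1 := hFΨ _ (F.starProjection_apply_mem (M a))
          have h2 := F.norm_starProjection_apply_le (M a)
          calc ‖Ψ (F.starProjection (M a))‖ ^ 2 ≤ (6 * ‖M a‖) ^ 2 := by
                gcongr
                exact h1.trans (by gcongr)
            _ = _ := by ring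
      _ ≤ 3 * n := by
          rw [← Finset.mul_sum]
          linarith
  set ε : ℝ := 1 / (12 * S) with hε
  have hε0 : 0 < ε := by positivity
  have hε12 : ε ≤ 1 / 12 := by
    rw [hε]
    gcongr
    linarith
  obtain ⟨N, hN, hNc⟩ := exists_finset_int_l1_ball (Fin (2 * n)) (3 * n)
  set Y : (Fin (2 * n) → ℤ) → Rn n := fun z => (ε / √n) • ∑ j, (z j : ℝ) • p j with hY
  set N' := N.filter fun z => 1 / 2 ≤ ‖Y z‖ with hN'
  set Ω : (Fin (2 * n) → ℤ) → Set (PiLp 2 fun _ : Fin k => Rn n) := fun z =>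
    {M | M ∈ Metric.closedBall 0 √k ∧ ∑ a, inner ℝ (M a) (Y z) ^ 2 ≤ (1 / (4 * S)) ^ 2} with hΩ
  have hpos : 0 < volume (Metric.closedBall (0 : PiLp 2 fun _ : Fin k => Rn n) √k) :=
    Metric.measure_closedBall_pos _ _ (Real.sqrt_pos.2 (Nat.cast_pos.2 hk0))
  have hfin : volume (Metric.closedBall (0 : PiLp 2 fun _ : Fin k => Rn n) √k) ≠ ⊤ :=
    measure_closedBall_lt_top.ne
  have hlt : volume (⋃ z ∈ N', Ω z) <
      volume (Metric.closedBall (0 : PiLp 2 fun _ : Fin k => Rn n) √k) := by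
    by_contra hle
    push Not at hle
    have hcard : (N'.card : ℝ) ≤ 72 ^ n := by
      have h1 : (N'.card : ℝ) ≤ N.card := by exact_mod_cast Finset.card_filter_le _ _
      refine h1.trans (hNc.trans (le_of_eq ?_))
      rw [Fintype.card_fin, pow_mul, pow_mul, ← mul_pow]
      norm_num
    have h1 : volume (Metric.closedBall (0 : PiLp 2 fun _ : Fin k => Rn n) √k) *
        ENNReal.ofReal (S ^ k) ≤ ENNReal.ofReal (1944 ^ n) *
          volume (Metric.closedBall (0 : PiLp 2 fun _ : Fin k => Rn n) √k) := by
      calc _ ≤ (∑ z ∈ N', volume (Ω z)) * ENNReal.ofReal (S ^ k) := by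
            gcongr
            exact hle.trans (measure_biUnion_finset_le _ _)
        _ = ∑ z ∈ N', volume (Ω z) * ENNReal.ofReal (S ^ k) := Finset.sum_mul _ _ _
        _ ≤ ∑ z ∈ N', ENNReal.ofReal (27 ^ n) *
              volume (Metric.closedBall (0 : PiLp 2 fun _ : Fin k => Rn n) √k) :=
            Finset.sum_le_sum fun z hz =>
              volume_small_at_le hk0 (Finset.mem_filter.1 hz).2 hS
        _ = ENNReal.ofReal (N'.card * 27 ^ n) *
              volume (Metric.closedBall (0 : PiLp 2 fun _ : Fin k => Rn n) √k) := by
            rw [Finset.sum_const, nsmul_eq_mul, ENNReal.ofReal_mul (Nat.cast_nonneg _),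
              ENNReal.ofReal_natCast, mul_assoc]
        _ ≤ _ := by
            gcongr
            rw [show (1944 : ℝ) = 72 * 27 by norm_num, mul_pow]
            gcongr
    rw [mul_comm, ENNReal.mul_le_mul_iff_left hpos.ne' hfin,
      ENNReal.ofReal_le_ofReal_iff (by positivity)] at h1
    exact absurd hSn (not_lt.2 h1)
  obtain ⟨M, hM, hMΩ⟩ : ∃ M ∈ Metric.closedBall (0 : PiLp 2 fun _ : Fin k => Rn n) √k,
      M ∉ ⋃ z ∈ N', Ω z := by
    by_contra hcon
    push Not at hcon
    exact absurd (measure_mono hcon) (not_le.2 hlt)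
  -- Pairing the identity with `M` lets a single rounding approximate both a vector and its values
  -- under the functionals.
  let L : Rn n →ₗ[ℝ] EuclideanSpace ℝ (Fin n ⊕ Fin k) :=
    { toFun := fun x => WithLp.toLp 2 (Sum.elim (fun i => x i) fun a => inner ℝ (M a) x)
      map_add' := fun x y => by ext (i | a) <;> simp [inner_add_right]
      map_smul' := fun c x => by ext (i | a) <;> simp [inner_smul_right] }
  have hL : ∀ x, ‖L x‖ ^ 2 = ‖x‖ ^ 2 + ∑ a, inner ℝ (M a) x ^ 2 := fun x => by
    rw [EuclideanSpace.real_norm_sq_eq, EuclideanSpace.real_norm_sq_eq, Fintype.sum_sum_type]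
    rfl
  let ψ : Rn n →ₗ[ℝ] (Fin k → ℝ) :=
    { toFun := fun x a => inner ℝ (M a) x
      map_add' := fun x y => by ext j; simp [inner_add_right]
      map_smul' := fun c x => by ext j; simp [inner_smul_right] }
  refine ⟨F ⊓ LinearMap.ker ψ, ?_, fun x hx u hu hxu => ?_⟩
  · have h1 := finrank_add_finrank_le_inf F (LinearMap.ker ψ)
    have h2 := LinearMap.finrank_range_add_finrank_ker ψ
    have h3 : finrank ℝ (LinearMap.range ψ) ≤ k := by
      simpa using Submodule.finrank_le (LinearMap.range ψ)
    rw [finrank_euclideanSpace_fin] at h1 h2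
    have h4 : finrank ℝ F ≤ finrank ℝ ↥(F ⊓ LinearMap.ker ψ) + k := by omega
    have h5 : (finrank ℝ F : ℝ) ≤ finrank ℝ ↥(F ⊓ LinearMap.ker ψ) + k := by exact_mod_cast h4
    linarith
  · by_contra hcon
    push Not at hcon
    have hx0 : 0 < ‖x‖ := by
      by_contra h
      have : ‖x‖ = 0 := le_antisymm (not_lt.1 h) (norm_nonneg _)
      rw [this, mul_zero] at hcon
      linarith
    have hxp : x = ∑ j, u j • p j := by
      have h1 : F.starProjection x = x := Submodule.starProjection_eq_self_iff.2 hx.1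
      rw [← h1]
      conv_lhs => rw [hxu]
      rw [map_sum]
      simp only [map_smul, hp]
    -- Scaled so that `(ε/√n) c x` is a unit vector; the assumption that `x` is long is exactly what
    -- gives `c ≤ n`, so the rounded coefficients lie in the counted set.
    set c : ℝ := √n / (ε * ‖x‖) with hc
    have hcn : c ≤ n := by
      rw [hc, div_le_iff₀ (by positivity)]
      have h1 : 1 ≤ √n * ‖x‖ * ε := by
        rw [hε, mul_one_div, le_div_iff₀ (by positivity)]
        linarith
      calc √(n : ℝ) = √n * 1 := by ring
        _ ≤ √n * (√n * ‖x‖ * ε) := by gcongr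
        _ = (√n * √n) * (ε * ‖x‖) := by ring
        _ = _ := by rw [Real.mul_self_sqrt hn'.le]
    have hc0 : 0 ≤ c := by positivity
    obtain ⟨z, hz, hzerr⟩ := exists_int_rounding (Finset.univ : Finset (Fin (2 * n)))
      (fun j => L (p j)) (fun j => c * u j)
    have hzN : z ∈ N := by
      refine hN z ?_
      calc ∑ j, |(z j : ℝ)| ≤ ∑ j, (c * |u j| + 1) := by
            refine Finset.sum_le_sum fun j _ => (hz j).trans_eq ?_
            rw [abs_mul, abs_of_nonneg hc0]
        _ = c * (∑ j, |u j|) + 2 * n := by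
            rw [Finset.sum_add_distrib, Finset.mul_sum]; simp
        _ ≤ n * 1 + 2 * n := by gcongr
        _ = ((3 * n : ℕ) : ℝ) := by push_cast; ring
    set x₁ := ‖x‖⁻¹ • x with hx₁
    have hx₁n : ‖x₁‖ = 1 := by
      rw [hx₁, norm_smul, norm_inv, norm_norm, inv_mul_cancel₀ hx0.ne']
    have hdiff : x₁ - Y z = (ε / √n) • ∑ j, (c * u j - z j) • p j := by
      simp only [sub_smul, Finset.sum_sub_distrib, smul_sub, hY, mul_smul, ← Finset.smul_sum]
      rw [← hxp, smul_smul, hx₁]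
      congr 2
      rw [hc]
      field_simp
    have hsumL : ∑ j, ‖L (p j)‖ ^ 2 ≤ 5 * n := by
      simp_rw [hL]
      rw [Finset.sum_add_distrib]
      have h1 : ∑ j, ‖p j‖ ^ 2 ≤ ∑ _j : Fin (2 * n), (1 : ℝ) :=
        Finset.sum_le_sum fun j _ => (sq_le_one_iff₀ (norm_nonneg _)).2 (hp1 j)
      simp only [Finset.sum_const, Finset.card_univ, Fintype.card_fin, nsmul_eq_mul, mul_one,
        Nat.cast_mul, Nat.cast_ofNat] at h1
      linarith [hMp M hM]
    have hLdiff : ‖L (x₁ - Y z)‖ ^ 2 ≤ 5 * ε ^ 2 := by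
      rw [hdiff, map_smul, map_sum, norm_smul, mul_pow]
      simp only [map_smul]
      calc ‖ε / √n‖ ^ 2 * ‖∑ j, (c * u j - z j) • L (p j)‖ ^ 2
          ≤ ‖ε / √n‖ ^ 2 * (5 * n) := by
            gcongr
            exact hzerr.trans hsumL
        _ = 5 * ε ^ 2 := by
            rw [Real.norm_eq_abs, sq_abs, div_pow, Real.sq_sqrt hn'.le]
            field_simp
    rw [hL] at hLdiff
    have hMx : ∀ a, inner ℝ (M a) x₁ = 0 := fun a => by
      have : ψ x = 0 := hx.2
      have h1 : inner ℝ (M a) x = 0 := congrFun this a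
      rw [hx₁, inner_smul_right, h1, mul_zero]
    have hMY : ∑ a, inner ℝ (M a) (x₁ - Y z) ^ 2 = ∑ a, inner ℝ (M a) (Y z) ^ 2 := by
      refine Finset.sum_congr rfl fun a _ => ?_
      rw [inner_sub_right, hMx]
      ring
    have hYn : 1 / 2 ≤ ‖Y z‖ := by
      have h1 : ‖x₁ - Y z‖ ≤ 3 * ε := by
        refine le_of_sq_le_sq ?_ (by positivity)
        have : 0 ≤ ∑ a, inner ℝ (M a) (x₁ - Y z) ^ 2 := Finset.sum_nonneg fun _ _ => sq_nonneg _
        nlinarith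
      have h2 := norm_sub_norm_le x₁ (Y z)
      linarith
    -- `M` vanishes at `x₁`, so its values at `Y z` are pure rounding error, with square sum at most
    -- `5ε² ≤ 9ε² = (1/(4S))²`, although `‖Y z‖ ≥ 1/2`. The choice of `M` excluded this.
    refine hMΩ (Set.mem_biUnion (x := z) ?_ ⟨hM, ?_⟩)
    · rw [hN', Finset.coe_filter]
      exact ⟨hzN, hYn⟩
    · rw [← hMY]
      have h1 : (1 / (4 * S)) ^ 2 = 9 * ε ^ 2 := by
        rw [hε]
        field_simp
        norm_num
      rw [h1]
      nlinarith [sq_nonneg ‖x₁ - Y z‖, sq_nonneg ε]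

open Module in
/-- A quotient of `ℓ₁²ⁿ` whose norm dominates the Euclidean norm of `ℝⁿ` dominates a multiple of
`n^{1/2}` times the Euclidean norm on a subspace of small codimension. -/
theorem exists_sqrt_mul_norm_le :
    ∃ C : ℝ, 0 < C ∧ ∀ (n : ℕ) (X : NormOn n),
      (∃ S : Submodule ℝ (PiLp 1 fun _ : Fin (2 * n) => ℝ),
        Nonempty (((PiLp 1 fun _ : Fin (2 * n) => ℝ) ⧸ S) ≃ₗᵢ[ℝ] X.Space)) →
      (∀ x : Rn n, ‖x‖ ≤ X.toSeminorm x) →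
      ∃ Z : Submodule ℝ (Rn n), (n : ℝ) ≤ finrank ℝ Z + n / 8 ∧
        ∀ x ∈ Z, √n * ‖x‖ ≤ C * X.toSeminorm x := by
  obtain ⟨S, hS1, hS⟩ : ∃ S : ℝ, 1 ≤ S ∧ ∀ n k : ℕ, 0 < k → n ≤ 32 * k →
      (1944 : ℝ) ^ n < S ^ k := by
    refine ⟨1944 ^ 32 + 1, by norm_num, fun n k hk hnk => ?_⟩
    calc (1944 : ℝ) ^ n ≤ 1944 ^ (32 * k) := pow_le_pow_right₀ (by norm_num) hnk
      _ = (1944 ^ 32) ^ k := pow_mul _ _ _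
      _ < _ := pow_lt_pow_left₀ (by norm_num) (by positivity) hk.ne'
  refine ⟨12 * S, by positivity, fun n X hX hX2 => ?_⟩
  rcases lt_or_ge n 16 with hn | hn
  · refine ⟨⊤, ?_, fun x _ => ?_⟩
    · rw [finrank_top, finrank_euclideanSpace_fin]
      have : (0 : ℝ) ≤ n / 8 := by positivity
      linarith
    · have h1 : √(n : ℝ) ≤ 12 * S := by
        refine (Real.sqrt_le_sqrt (y := 16) (by exact_mod_cast hn.le)).trans ?_
        rw [show (16 : ℝ) = 4 ^ 2 by norm_num, Real.sqrt_sq (by norm_num)]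
        linarith
      exact mul_le_mul h1 (hX2 x) (norm_nonneg _) (by positivity)
  · obtain ⟨v, hv, hvx⟩ := exists_vertices X hX
    obtain ⟨Z, hZ, hZx⟩ := exists_small_section hn hS1 (hS n (n / 16) (by omega) (by omega)) v
      fun j => (hX2 _).trans (hv j)
    refine ⟨Z, hZ, fun x hx => ?_⟩
    refine le_of_forall_pos_le_add fun δ hδ => ?_
    -- The hull representation needs norm strictly below `1`, hence the slack `δ`.
    set r := X.toSeminorm x + δ / (12 * S) with hr
    have hxr : X.toSeminorm x < r := by
      have : 0 < δ / (12 * S) := by positivity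
      linarith
    have hr0 : 0 < r := (apply_nonneg X.toSeminorm x).trans_lt hxr
    obtain ⟨u, hu, hxu⟩ := hvx (r⁻¹ • x) (by
      rw [map_smul_eq_mul, norm_inv, Real.norm_of_nonneg hr0.le, inv_mul_lt_iff₀ hr0]
      linarith)
    have h := hZx _ (Z.smul_mem r⁻¹ hx) u hu hxu
    rw [norm_smul, norm_inv, Real.norm_of_nonneg hr0.le, mul_left_comm, inv_mul_le_iff₀ hr0] at h
    refine h.trans_eq ?_
    rw [hr]
    field_simp

/-! ### Gelfand numbers and the final estimates. -/

open Module in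
theorem NormOn.gelfandNumber_op_le {n : ℕ} (X : NormOn n) {k : ℕ} (u : Rn n →L[ℝ] Rn n) {c : ℝ}
    (hc : 0 ≤ c) (Z : Submodule ℝ (Rn n)) (hZ : n < finrank ℝ Z + k)
    (h : ∀ x ∈ Z, X.toSeminorm (u x) ≤ c * X.toSeminorm x) :
    gelfandNumber k (X.op u) ≤ c := by
  set W : Submodule ℝ X.Space := Z.map X.toSpace.toLinearMap with hW
  have hWdim : finrank ℝ W = finrank ℝ Z := LinearEquiv.finrank_map_eq X.toSpace Z
  have hrank : Module.rank ℝ (X.Space ⧸ W) < k := by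
    rw [← finrank_eq_rank, Nat.cast_lt]
    have h1 := W.finrank_quotient_add_finrank
    have h2 : finrank ℝ X.Space = n := by
      rw [← X.toSpace.finrank_eq, finrank_euclideanSpace_fin]
    omega
  refine (ciInf_le ⟨0, ?_⟩ (⟨W, hrank⟩ : {Z : Submodule ℝ X.Space //
    Module.rank ℝ (X.Space ⧸ Z) < k})).trans ?_
  · rintro _ ⟨Z, rfl⟩
    exact ContinuousLinearMap.opNorm_nonneg _
  · refine ContinuousLinearMap.opNorm_le_bound _ hc ?_
    rintro ⟨_, x, hx, rfl⟩
    exact h x hx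

open Module in
theorem NormOn.le_gelfandNumber_op {n : ℕ} (X : NormOn n) {k : ℕ} (hk : 0 < k)
    (u : Rn n →L[ℝ] Rn n) {c : ℝ}
    (h : ∀ Z : Submodule ℝ (Rn n), n < finrank ℝ Z + k →
      ∃ x ∈ Z, x ≠ 0 ∧ c * X.toSeminorm x ≤ X.toSeminorm (u x)) :
    c ≤ gelfandNumber k (X.op u) := by
  have : Nonempty {Z : Submodule ℝ X.Space // Module.rank ℝ (X.Space ⧸ Z) < k} := by
    refine ⟨⟨⊤, ?_⟩⟩
    rw [← finrank_eq_rank, Nat.cast_lt]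
    have h1 := (⊤ : Submodule ℝ X.Space).finrank_quotient_add_finrank
    rw [finrank_top] at h1
    omega
  refine le_ciInf fun W => ?_
  obtain ⟨W, hW⟩ := W
  set Z : Submodule ℝ (Rn n) := W.map X.toSpace.symm.toLinearMap with hZ
  have hZdim : finrank ℝ Z = finrank ℝ W := LinearEquiv.finrank_map_eq X.toSpace.symm W
  obtain ⟨_, ⟨w, hw, rfl⟩, hx0, hx⟩ := h Z (by
    rw [← finrank_eq_rank, Nat.cast_lt] at hW
    have h1 := W.finrank_quotient_add_finrank
    have h2 : finrank ℝ X.Space = n := by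
      rw [← X.toSpace.finrank_eq, finrank_euclideanSpace_fin]
    omega)
  have hw0 : 0 < ‖w‖ := norm_pos_iff.2 fun h0 => hx0 (by rw [h0, map_zero])
  have h3 : ‖X.op u w‖ ≤ ‖(X.op u).comp W.subtypeL‖ * ‖w‖ :=
    ((X.op u).comp W.subtypeL).le_opNorm ⟨w, hw⟩
  exact le_of_mul_le_mul_right (hx.trans h3) hw0

/-- An antisymmetric contraction of `ℝⁿ` which is isometric on a hyperplane. -/
theorem exists_antisymmetric_isometry {n : ℕ} :
    ∃ (T : Rn n →L[ℝ] Rn n) (H : Submodule ℝ (Rn n)), n ≤ Module.finrank ℝ H + 1 ∧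
      (∀ x, inner ℝ (T x) x = 0) ∧ (∀ x, ‖T x‖ ≤ ‖x‖) ∧ ∀ x ∈ H, ‖T x‖ = ‖x‖ := by
  classical
  -- Coordinates are paired and each pair is turned by a right angle; for odd `n` the unpaired
  -- coordinate is sent to zero, which costs the one dimension.
  obtain ⟨e⟩ : Nonempty (Fin n ≃ (Fin (n / 2) × Bool) ⊕ Fin (n % 2)) :=
    Fintype.card_eq.1 (by simp; omega)
  let t : Rn n → (Fin (n / 2) × Bool) ⊕ Fin (n % 2) → ℝ := fun x =>
    Sum.elim (fun p => cond p.2 (x (e.symm (Sum.inl (p.1, false))))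
      (-x (e.symm (Sum.inl (p.1, true))))) fun _ => 0
  let T₀ : Rn n →ₗ[ℝ] Rn n :=
    { toFun := fun x => WithLp.toLp 2 fun i => t x (e i)
      map_add' := fun x y => by
        ext i
        rcases h : e i with ⟨a, (b | b)⟩ | a <;> simp [t, h]
        ring
      map_smul' := fun c x => by
        ext i
        rcases h : e i with ⟨a, (b | b)⟩ | a <;> simp [t, h] }
  have hT₀ : ∀ x i, T₀ x i = t x (e i) := fun _ _ => rfl
  have hnormT : ∀ x, ‖T₀ x‖ ^ 2 = ∑ a, (x (e.symm (Sum.inl (a, false))) ^ 2 +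
      x (e.symm (Sum.inl (a, true))) ^ 2) := fun x => by
    rw [EuclideanSpace.real_norm_sq_eq, ← e.symm.sum_comp]
    simp [hT₀, t, Fintype.sum_prod_type]
  have hnorm : ∀ x : Rn n, ‖x‖ ^ 2 = ∑ a, (x (e.symm (Sum.inl (a, false))) ^ 2 +
      x (e.symm (Sum.inl (a, true))) ^ 2) + ∑ b, x (e.symm (Sum.inr b)) ^ 2 := fun x => by
    rw [EuclideanSpace.real_norm_sq_eq, ← e.symm.sum_comp]
    simp [Fintype.sum_prod_type, add_comm]
  let ψ : Rn n →ₗ[ℝ] (Fin (n % 2) → ℝ) :=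
    { toFun := fun x b => x (e.symm (Sum.inr b))
      map_add' := fun x y => rfl
      map_smul' := fun c x => rfl }
  refine ⟨LinearMap.toContinuousLinearMap T₀, LinearMap.ker ψ, ?_, fun x => ?_, fun x => ?_,
    fun x hx => ?_⟩
  · have h2 := LinearMap.finrank_range_add_finrank_ker ψ
    have h3 : Module.finrank ℝ (LinearMap.range ψ) ≤ n % 2 := by
      simpa using Submodule.finrank_le (LinearMap.range ψ)
    rw [finrank_euclideanSpace_fin] at h2
    omega
  · change inner ℝ (T₀ x) x = 0
    rw [PiLp.inner_apply, ← e.symm.sum_comp]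
    simp [hT₀, t, Fintype.sum_prod_type, mul_comm]
  · change ‖T₀ x‖ ≤ ‖x‖
    refine le_of_sq_le_sq ?_ (norm_nonneg _)
    rw [hnormT, hnorm]
    exact le_add_of_nonneg_right (Finset.sum_nonneg fun _ _ => sq_nonneg _)
  · change ‖T₀ x‖ = ‖x‖
    have hb : ∀ b, x (e.symm (Sum.inr b)) = 0 := fun b => congrFun (show ψ x = 0 from hx) b
    refine (sq_eq_sq₀ (norm_nonneg _) (norm_nonneg _)).1 ?_
    rw [hnormT, hnorm]
    simp [hb]

open Module in
theorem theorem2p2 :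
    (∃ c : ℝ, 0 < c ∧ ∀ n : ℕ, 2 ≤ n → ∃ X : NormOn n, IsMankiewiczNorm c X) ∧
    (∀ c : ℝ, 0 < c → ∃ K : ℝ, 0 < K ∧ ∃ κ : ℝ, 0 < κ ∧
      ∀ n : ℕ, 2 ≤ n → ∀ X : NormOn n, IsMankiewiczNorm c X →
        (∀ T : Rn n →L[ℝ] Rn n,
          (⨅ l : ℝ, gelfandNumber (n / 2) (X.op (T - l • ContinuousLinearMap.id ℝ (Rn n)))) ≤
            K * (n : ℝ) ^ (-1 / 2 : ℝ) * ‖X.op T‖) ∧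
        (∃ T : Rn n →L[ℝ] Rn n, T ≠ 0 ∧
          κ * (n : ℝ) ^ (-1 / 2 : ℝ) * ‖X.op T‖ ≤
            ⨅ l : ℝ, gelfandNumber (n / 2)
              (X.op (T - l • ContinuousLinearMap.id ℝ (Rn n))))) := by
  refine ⟨exists_isMankiewiczNorm, fun c hc => ?_⟩
  obtain ⟨C, hC, hsec⟩ := exists_sqrt_mul_norm_le
  refine ⟨c * C, by positivity, 1 / C, by positivity, fun n hn X hX => ?_⟩
  have hn' : (0 : ℝ) < n := by positivity
  have hsn : (0 : ℝ) < √n := Real.sqrt_pos.2 hn'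
  obtain ⟨Z₀, hZ₀, hZ₀C⟩ := hsec n X hX.quotient hX.euclidean_le
  have hXle : ∀ x, X.toSeminorm x ≤ √n * ‖x‖ := fun x =>
    (hX.le_l1 x).trans (sum_abs_le_sqrt_mul_norm x)
  rw [natCast_rpow_neg_half]
  refine ⟨fun T => ?_, ?_⟩
  · obtain ⟨l, E, hE, -, hEl⟩ := hX.perturbation T
    rw [natCast_rpow_neg_half] at hEl
    refine (ciInf_le ⟨0, ?_⟩ (-l)).trans ?_
    · rintro _ ⟨l, rfl⟩
      exact Real.iInf_nonneg fun _ => ContinuousLinearMap.opNorm_nonneg _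
    -- The codimension is below `n/4`. Passing from `X` to the Euclidean norm gains `C/√n` on `Z₀`
    -- and passing back loses `√n`, so the Euclidean bound on `E` carries over with the factor `C`.
    refine X.gelfandNumber_op_le _ (by positivity) (Z₀ ⊓ E) ?_ fun x hx => ?_
    · have h1 := finrank_add_finrank_le_inf Z₀ E
      rw [finrank_euclideanSpace_fin] at h1
      have h1' : (finrank ℝ Z₀ + finrank ℝ E : ℝ) ≤ finrank ℝ ↥(Z₀ ⊓ E) + n := by
        exact_mod_cast h1
      have h2 : (3 * n : ℝ) < 4 * finrank ℝ ↥(Z₀ ⊓ E) := by linarith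
      have h2' : 3 * n < 4 * finrank ℝ ↥(Z₀ ⊓ E) := by exact_mod_cast h2
      omega
    · obtain ⟨hxZ, hxE⟩ := hx
      have h1 := ((T + l • ContinuousLinearMap.id ℝ (Rn n)).comp E.subtypeL).le_of_opNorm_le hEl
        ⟨x, hxE⟩
      have e : (T - (-l) • ContinuousLinearMap.id ℝ (Rn n)) x =
          ((T + l • ContinuousLinearMap.id ℝ (Rn n)).comp E.subtypeL) ⟨x, hxE⟩ := by
        change T x - (-l) • x = T x + l • x
        rw [neg_smul, sub_neg_eq_add]
      rw [e]
      refine (hXle _).trans ?_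
      calc √n * ‖((T + l • ContinuousLinearMap.id ℝ (Rn n)).comp E.subtypeL) ⟨x, hxE⟩‖
          ≤ √n * (c * (√n)⁻¹ * ‖X.op T‖ * ‖x‖) := by gcongr; exact h1
        _ = c * ‖X.op T‖ * (√n)⁻¹ * (√n * ‖x‖) := by ring
        _ ≤ c * ‖X.op T‖ * (√n)⁻¹ * (C * X.toSeminorm x) :=
            mul_le_mul_of_nonneg_left (hZ₀C x hxZ) (by positivity)
        _ = _ := by ring
  · obtain ⟨T, H, hH, hT0, hT1, hTH⟩ := exists_antisymmetric_isometry (n := n)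
    have hTX : ‖X.op T‖ ≤ √n := by
      refine ContinuousLinearMap.opNorm_le_bound _ (Real.sqrt_nonneg _) fun w => ?_
      have h1 : X.toSeminorm (T (X.toSpace.symm w)) ≤ √n * X.toSeminorm (X.toSpace.symm w) :=
        (hXle _).trans (by
          gcongr
          exact (hT1 _).trans (hX.euclidean_le _))
      exact h1
    refine ⟨T, ?_, ?_⟩
    · rintro rfl
      have hpos : 0 < finrank ℝ H := by omega
      obtain ⟨x, hx0⟩ := (finrank_pos_iff_exists_ne_zero (R := ℝ)).1 hpos
      have := hTH x x.2
      rw [zero_apply, norm_zero] at this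
      exact hx0 (Subtype.ext (norm_eq_zero.1 this.symm))
    have h1C : 1 / C * (√n)⁻¹ * ‖X.op T‖ ≤ 1 / C := by
      calc 1 / C * (√n)⁻¹ * ‖X.op T‖ ≤ 1 / C * (√n)⁻¹ * √n := by gcongr
        _ = 1 / C := by rw [mul_assoc, inv_mul_cancel₀ hsn.ne', mul_one]
    refine h1C.trans (le_ciInf fun l => X.le_gelfandNumber_op (by omega) _ fun Z hZ => ?_)
    set A : Rn n →L[ℝ] Rn n := T - l • ContinuousLinearMap.id ℝ (Rn n) with hA
    have hAx : ∀ x, A x = T x - l • x := fun x => rfl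
    -- Antisymmetry removes the cross term: `‖Tx - l x‖² = ‖x‖² + l²‖x‖²`, uniformly in `l`.
    have hAn : ∀ x ∈ H, ‖x‖ ≤ ‖A x‖ := fun x hx => by
      refine le_of_sq_le_sq ?_ (norm_nonneg _)
      rw [hAx, norm_sub_sq_real, inner_smul_right, hT0, hTH x hx, norm_smul]
      nlinarith [sq_nonneg (‖l‖ * ‖x‖)]
    set V := Z ⊓ H with hV
    have hker : ∀ x ∈ V, A x = 0 → x = 0 := fun x hx h0 => by
      have := hAn x hx.2
      rw [h0, norm_zero] at this
      exact norm_le_zero_iff.1 this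
    have hAV : finrank ℝ (V.map A.toLinearMap) = finrank ℝ V := by
      have hinj : Function.Injective (A.toLinearMap.domRestrict V) := by
        rw [← LinearMap.ker_eq_bot, LinearMap.ker_eq_bot']
        exact fun x hx => Subtype.ext (hker x x.2 hx)
      rw [← LinearMap.finrank_range_of_inj hinj, LinearMap.range_domRestrict]
    -- `A` is injective on `V`, whose dimension is at least `n/2` after losing at most one to `H`;
    -- with `dim Z₀ ≥ 7n/8` the sum exceeds `n`.
    obtain ⟨y, hy, hy0⟩ : ∃ y ∈ V.map A.toLinearMap ⊓ Z₀, y ≠ 0 := by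
      have h1 := finrank_add_finrank_le_inf Z H
      have h2 := finrank_add_finrank_le_inf (V.map A.toLinearMap) Z₀
      rw [finrank_euclideanSpace_fin, ← hV] at h1
      rw [finrank_euclideanSpace_fin, hAV] at h2
      have hZ₀' : 7 * n ≤ 8 * finrank ℝ Z₀ := by
        have : (7 * n : ℝ) ≤ 8 * finrank ℝ Z₀ := by linarith
        exact_mod_cast this
      have hpos : 0 < finrank ℝ ↥(V.map A.toLinearMap ⊓ Z₀) := by omega
      obtain ⟨y, hy0⟩ := (finrank_pos_iff_exists_ne_zero (R := ℝ)).1 hpos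
      exact ⟨y, y.2, fun h => hy0 (Subtype.ext h)⟩
    obtain ⟨⟨x, hx, rfl⟩, hyZ⟩ := hy
    refine ⟨x, hx.1, ?_, ?_⟩
    · rintro rfl
      exact hy0 (map_zero _)
    · have h1 : √n * ‖A x‖ ≤ C * X.toSeminorm (A x) := hZ₀C _ hyZ
      rw [one_div, inv_mul_le_iff₀ hC]
      calc X.toSeminorm x ≤ √n * ‖x‖ := hXle x
        _ ≤ √n * ‖A x‖ := by
            gcongr
            exact hAn x hx.2
        _ ≤ _ := h1
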